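/- **Lemma (Estimator Lipschitz property).** *Setting.* Let $\overline\Omega\subset\mathbb R^2$ be the union of finitely many closed squares of a uniform axis-parallel grid, let $\Omega$ be its interior, and let $f\in L^2(\Omega)$. Let $P$ be a hierarchical partition of $\Omega$: level $0$ consists of the given squares, finitely many times some squares of level $\ell$ are divided into four squares of level $\ell+1$, and $P$ consists of the (open) squares $\tau$ that are not divided. Let $\overline\Omega=\Omega^0\supseteq\Omega^1\supseteq\cdots$, where $\Omega^\ell$ is the union of all closed squares of level $\ell$ so generated. Fix a degree $r\ge2$. For each level $\ell$ consider the tensor-product B-splines of degree $r$ in each variable, whose knots in each coordinate lie on all grid lines of level $\ell$, with multiplicities that do not decrease with the level and are at most $r-1$ on grid lines meeting $\Omega$ (so that the splines are $C^1$ in $\Omega$). The hierarchical basis consists of the B-splines $\beta$ of level $\ell=0,1,\dots$ with $\operatorname{supp}\beta\subseteq\Omega^\ell$ and $\operatorname{supp}\beta\not\subseteq\Omega^{\ell+1}$ (supports taken in $\overline\Omega$), and $\mathbb X_P$ is its span. The support extension $\omega_\tau$ of $\tau\in P$ is the collection (and, as a set, the interior of the union of the closures) of all $\tau'\in P$ for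 which some basis function $\beta$ satisfies $\operatorname{supp}\beta\cap\tau'\ne\emptyset$ and $\operatorname{supp}\beta\cap\tau\neq\emptyset$. An interior edge $\sigma$ is the common boundary segment, without vertices, of two cells of $P$ (a full side of the smaller one); a boundary edge is an open side of a cell contained in $\partial\Omega$. Put $h_\tau=\operatorname{diam}\tau$, $h_\sigma=\operatorname{diam}\sigma$. The partition is shape regular with constant $c_{\rm shape}>0$ if for all $\tau\in P$ $$\#\omega_\tau\le c_{\rm shape},\qquad \frac{h_\tau}{h_\sigma}\le c_{\rm shape}\ \text{ for every edge }\sigma\subset\partial\tau,\qquad \frac{\operatorname{diam}\omega_\tau}{h_\tau}\le c_{\rm shape}.$$ For $V\in\mathbb X_P$ and $\tau\in P$ the error indicator $\eta_P(V,\tau)\ge0$ is given by $$\eta_P^2(V,\tau)=h_\tau^4\|f-\Delta^2V\|_{L^2(\tau)}^2+\sum_{\sigma\subset\partial\tau}\Big(h_\sigma^3\big\|[\![\partial_{n_\sigma}\Delta V]\!]_\sigma\big\|_{L^2(\sigma)}^2+h_\sigma\big\|[\![\Delta V]\!]_\sigma\big\|_{L^2(\sigma)}^2\Big),$$ where the sum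 is over the interior edges $\sigma\subset\partial\tau$, $n_\sigma$ is a unit normal of $\sigma$, and $[\![\cdot]\!]_\sigma$ is the difference of the traces from the two cells that share $\sigma$. *Claim.* For every $r\ge2$ and $c_{\rm shape}>0$ there is a constant $C_{\rm lip}>0$, depending only on $r$ and $c_{\rm shape}$, such that for all $\Omega$, $f$, $P$ and $\mathbb X_P$ as above with $P$ shape regular with constant $c_{\rm shape}$, every cell $\tau\in P$ and all $V,W\in\mathbb X_P$, $$|\eta_P(V,\tau)-\eta_P(W,\tau)|\le C_{\rm lip}\,|V-W|_{H^2(\omega_\tau)},$$ where $|v|_{H^2(\omega)}^2=\sum_{|\alpha|=2}\|D^\alpha v\|_{L^2(\omega)}^2$ with weak derivatives. -/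

import Mathlib

open MeasureTheory Set Filter Topology
open scoped ENNReal ContDiff

noncomputable section

/-- The Euclidean plane. -/
abbrev Plane : Type := EuclideanSpace ℝ (Fin 2)

/-- The coordinate unit vectors. -/
def unitVec (d : Fin 2) : Plane := EuclideanSpace.single d 1

/-! ### The Sobolev seminorm `|v|_{H²(U)}` -/

/-- `g` is the weak derivative `∂_i ∂_j v` on the open set `U`. -/
def IsWeakSecondDeriv (U : Set Plane) (i j : Fin 2) (v g : Plane → ℝ) : Prop :=
  LocallyIntegrableOn v U ∧ LocallyIntegrableOn g U ∧
    ∀ φ : Plane → ℝ, ContDiff ℝ ∞ φ → HasCompactSupport φ → tsupport φ ⊆ U →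
      ∫ x in U, v x * fderiv ℝ (fun y => fderiv ℝ φ y (unitVec j)) x (unitVec i)
        = ∫ x in U, g x * φ x

/-- `|v|_{H²(U)} = (∑_{|α| = 2} ‖D^α v‖²_{L²(U)})^{1/2}` with weak derivatives; it is `∞` if the
weak second derivatives do not exist or are not square integrable.  (Weak derivatives are unique
almost everywhere, so the infimum runs over copies of one value.) -/
def h2Seminorm (U : Set Plane) (v : Plane → ℝ) : ℝ≥0∞ :=
  ⨅ (g : Fin 2 → Fin 2 → Plane → ℝ) (_ : ∀ i j, IsWeakSecondDeriv U i j v (g i j)),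
    (∑ i : Fin 2, ∑ j ∈ Finset.Ici i, ∫⁻ x in U, ‖g i j x‖ₑ ^ 2) ^ (1 / 2 : ℝ)

/-! ### Univariate B-splines -/

/-- The B-spline of degree `p` with knots `ξ i ≤ … ≤ ξ (i + p + 1)` (Cox–de Boor recursion; a term
with vanishing denominator is zero). -/
def bspline (ξ : ℤ → ℝ) : ℕ → ℤ → ℝ → ℝ
  | 0, i, t => if ξ i ≤ t ∧ t < ξ (i + 1) then 1 else 0
  | p + 1, i, t =>
      (t - ξ i) / (ξ (i + p + 1) - ξ i) * bspline ξ p i t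
        + (ξ (i + p + 2) - t) / (ξ (i + p + 2) - ξ (i + 1)) * bspline ξ p (i + 1) t

/-! ### Hierarchical partitions into squares -/

/-- The indices of the four subsquares of each square with index in `S`. -/
def childIdx (S : Finset (Fin 2 → ℤ)) : Finset (Fin 2 → ℤ) :=
  S.biUnion fun k => Fintype.piFinset fun d => {2 * k d, 2 * k d + 1}

/-- The squares of level `ℓ` that are generated when, starting from the squares `init` of level
`0`, the squares `refined m` of level `m` are divided into four, `m = 0, 1, …`. -/
def levelIdx (init : Finset (Fin 2 → ℤ)) (refined : ℕ → Finset (Fin 2 → ℤ)) :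
    ℕ → Finset (Fin 2 → ℤ)
  | 0 => init
  | ℓ + 1 => childIdx (refined ℓ)

/-- A hierarchical partition: finitely many squares `init` of a uniform grid, and for each level
the squares of that level which are divided into four. -/
structure HierMesh where
  origin : Plane
  h : ℝ
  h_pos : 0 < h
  init : Finset (Fin 2 → ℤ)
  refined : ℕ → Finset (Fin 2 → ℤ)
  refined_subset : ∀ ℓ, refined ℓ ⊆ levelIdx init refined ℓ
  depth : ℕ
  refined_eq_empty : ∀ ℓ, depth ≤ ℓ → refined ℓ = ∅

/-- The level and the integer position of a square. -/
abbrev CellIdx : Type := ℕ × (Fin 2 → ℤ)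

namespace HierMesh

variable (M : HierMesh)

/-- The `k`-th grid line of level `ℓ` orthogonal to the axis `d`. -/
def grid (d : Fin 2) (ℓ : ℕ) (k : ℤ) : ℝ := M.origin d + M.h * k / 2 ^ ℓ

/-- The open square with the given index. -/
def cell (τ : CellIdx) : Set Plane :=
  {x | ∀ d, x d ∈ Ioo (M.grid d τ.1 (τ.2 d)) (M.grid d τ.1 (τ.2 d + 1))}

/-- The closed square with the given index. -/
def closedCell (τ : CellIdx) : Set Plane :=
  {x | ∀ d, x d ∈ Icc (M.grid d τ.1 (τ.2 d)) (M.grid d τ.1 (τ.2 d + 1))}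

/-- The four corners of a square. -/
def vertices (τ : CellIdx) : Set Plane :=
  {x | ∀ d, x d = M.grid d τ.1 (τ.2 d) ∨ x d = M.grid d τ.1 (τ.2 d + 1)}

/-- The partition `P`: the squares of all levels that are not divided further. -/
def cells : Finset CellIdx :=
  (Finset.range (M.depth + 1)).biUnion fun ℓ =>
    (levelIdx M.init M.refined ℓ \ M.refined ℓ).image fun k => (ℓ, k)

/-- The nested closed subdomains `Ω⁰ ⊇ Ω¹ ⊇ …`; the partition has level at least `ℓ` in `Ω^ℓ`. -/
def subdomain (ℓ : ℕ) : Set Plane :=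
  ⋃ k ∈ levelIdx M.init M.refined ℓ, M.closedCell (ℓ, k)

/-- The domain `Ω`. -/
def dom : Set Plane := interior (M.subdomain 0)

/-- `h_τ`. -/
def cellSize (τ : CellIdx) : ℝ := Metric.diam (M.cell τ)

/-! ### Edges -/

/-- The common edge, without vertices, of two distinct cells of the partition
(empty if they meet at most in a vertex).  If one of the cells is smaller than the other,
then this is a full side of the smaller cell. -/
def edge (τ τ' : CellIdx) : Set Plane :=
  (M.closedCell τ ∩ M.closedCell τ') \ (M.vertices τ ∪ M.vertices τ')

open Classical in
/-- The cells that share an edge with `τ`; they correspond to the interior edges `σ ⊂ ∂τ`. -/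
def neighbors (τ : CellIdx) : Finset CellIdx :=
  M.cells.filter fun τ' => τ' ≠ τ ∧ (M.edge τ τ').Nonempty

/-- The edges `σ ⊂ ∂τ` on the boundary of the domain. -/
def boundaryEdges (τ : CellIdx) : Set (Set Plane) :=
  {σ | σ ⊆ frontier M.dom ∧ ∃ d : Fin 2, ∃ k ∈ ({τ.2 d, τ.2 d + 1} : Set ℤ),
    σ = {x | x d = M.grid d τ.1 k ∧
      ∀ d', d' ≠ d → x d' ∈ Ioo (M.grid d' τ.1 (τ.2 d')) (M.grid d' τ.1 (τ.2 d' + 1))}}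

/-- All edges `σ ⊂ ∂τ` of the partition. -/
def edgesOf (τ : CellIdx) : Set (Set Plane) :=
  {σ | ∃ τ' ∈ M.neighbors τ, σ = M.edge τ τ'} ∪ M.boundaryEdges τ

open Classical in
/-- A unit normal vector of the common edge of two cells. -/
def edgeNormal (τ τ' : CellIdx) : Plane :=
  if ∃ t : ℝ, ∀ x ∈ M.edge τ τ', x 0 = t then unitVec 0 else unitVec 1

/-- The trace at the boundary point `x` of `τ` of a function on the open cell `τ`. -/
def trace (τ : CellIdx) (g : Plane → ℝ) (x : Plane) : ℝ := limUnder (𝓝[M.cell τ] x) g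

/-- The jump of `g` at a point `x` of the common edge of `τ` and `τ'`. -/
def jump (τ τ' : CellIdx) (g : Plane → ℝ) (x : Plane) : ℝ := M.trace τ g x - M.trace τ' g x

/-- `η_P²(V, τ) = h_τ⁴ ‖f - Δ²V‖²_{L²(τ)}
  + ∑_{σ ⊂ ∂τ} (h_σ³ ‖⟦∂ΔV/∂n_σ⟧‖²_{L²(σ)} + h_σ ‖⟦ΔV⟧‖²_{L²(σ)})`, with the sum over the
interior edges. -/
def etaSq (f V : Plane → ℝ) (τ : CellIdx) : ℝ :=
  M.cellSize τ ^ 4 *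
    (∫ x in M.cell τ, (f x - Laplacian.laplacian (Laplacian.laplacian V) x) ^ 2)
  + ∑ τ' ∈ M.neighbors τ,
    (Metric.diam (M.edge τ τ') ^ 3 *
        (∫ x in M.edge τ τ', (M.jump τ τ'
          (fun y => fderiv ℝ (Laplacian.laplacian V) y (M.edgeNormal τ τ')) x) ^ 2
            ∂(Measure.hausdorffMeasure 1))
      + Metric.diam (M.edge τ τ') *
        (∫ x in M.edge τ τ', (M.jump τ τ' (Laplacian.laplacian V) x) ^ 2
            ∂(Measure.hausdorffMeasure 1)))

/-- The error indicator `η_P(V, τ)`. -/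
def eta (f V : Plane → ℝ) (τ : CellIdx) : ℝ := √(M.etaSq f V τ)

end HierMesh

/-! ### Hierarchical B-splines -/

/-- Knot sequences for tensor product splines of degree `r`, for each axis and each level: the
knots of level `ℓ` lie on all grid lines of level `ℓ`, with multiplicities that do not decrease
with the level, and that are at most `r - 1` on lines which meet the domain, so that the splines
are of class `C¹` there.  (On other lines, for instance along the boundary of a rectangle, the
multiplicity is arbitrary.) -/
structure KnotSystem (M : HierMesh) (r : ℕ) where
  knot : Fin 2 → ℕ → ℤ → ℝ
  mono : ∀ d ℓ, Monotone (knot d ℓ)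
  range_eq : ∀ d ℓ, range (knot d ℓ) = range (M.grid d ℓ)
  nested : ∀ d ℓ t, {i | knot d ℓ i = t}.ncard ≤ {i | knot d (ℓ + 1) i = t}.ncard
  mult_lt : ∀ d ℓ t, (∃ x ∈ M.dom, x d = t) → {i | knot d ℓ i = t}.ncard < r

namespace KnotSystem

variable {M : HierMesh} {r : ℕ} (K : KnotSystem M r)

/-- The tensor product B-spline of level `q.1` with position `q.2`. -/
def tensorBspline (q : CellIdx) (x : Plane) : ℝ :=
  ∏ d, bspline (K.knot d q.1) r (q.2 d) (x d)

/-- The support of a tensor product B-spline, as a function on `Ω`. -/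
def supp (q : CellIdx) : Set Plane := closure (Function.support (K.tensorBspline q) ∩ M.dom)

/-- The hierarchical basis consists of the B-splines of level `ℓ = 0, 1, …` whose support is
contained in `Ω^ℓ` but not in `Ω^{ℓ+1}`. -/
def IsBasisIdx (q : CellIdx) : Prop :=
  K.supp q ⊆ M.subdomain q.1 ∧ ¬ K.supp q ⊆ M.subdomain (q.1 + 1)

/-- The spline space `X_P`, spanned by the hierarchical basis; splines are written as functions on
the plane, but only their values on `Ω` are used. -/
def splineSpace : Submodule ℝ (Plane → ℝ) :=
  Submodule.span ℝ (K.tensorBspline '' {q | K.IsBasisIdx q})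

/-- The cells of the support extension of `τ`: those met by the support of a basis function whose
support meets `τ`. -/
def suppExt (τ : CellIdx) : Set CellIdx :=
  {τ' | τ' ∈ M.cells ∧ ∃ q, K.IsBasisIdx q ∧
    (K.supp q ∩ M.cell τ').Nonempty ∧ (K.supp q ∩ M.cell τ).Nonempty}

/-- The support extension `ω_τ` as an open subset of `Ω`. -/
def suppExtDom (τ : CellIdx) : Set Plane := interior (⋃ τ' ∈ K.suppExt τ, M.closedCell τ')

/-- Shape regularity with constant `c`. -/
structure ShapeRegular (c : ℝ) : Prop where
  finite_intersection : ∀ τ ∈ M.cells, ((K.suppExt τ).ncard : ℝ) ≤ c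
  mesh_grading : ∀ τ ∈ M.cells, ∀ σ ∈ M.edgesOf τ, M.cellSize τ / Metric.diam σ ≤ c
  quasi_uniformity : ∀ τ ∈ M.cells, Metric.diam (K.suppExtDom τ) / M.cellSize τ ≤ c

end KnotSystem

end

/-!
On each cell `τ`, splines are polynomials of degree at most `r` in each variable. The indicator
`η(V, τ)` is a weighted Euclidean norm of `L²` norms that depend affinely on `V`, so by the triangle
inequality `|η(V, τ) - η(W, τ)|` is at most the indicator of `U = V - W` for `f = 0`. Every term of
the latter involves only `ΔU`. On the unit square all (semi)norms of polynomials of bounded degree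
are controlled by the `L²` norm, and scaling turns this into inverse estimates which bound every
term by `‖ΔU‖` in `L²` of `τ` and of the cells that share an edge with `τ`.

An edge between cells of side lengths `s` and `s'` has length `m = min s s'`, and its term is at
most a constant times `(m / s)² ‖ΔU‖²_{L²(τ)} + ‖ΔU‖²_{L²(τ')}`. Each neighbour contains a square of
area `m²` within the threefold enlargement of `τ`, so the numbers `(m / s)²` sum to at most `9`.

The interiors of the supports of the basis functions cover `Ω`; a basis function that is supported
around a point of the common edge of two cells meets both of them, so the neighbours of `τ` belong
to `ω_τ`. Finally, on every cell `ΔU` is the sum of the two pure weak second derivatives.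
-/

noncomputable section

/-! ### Boxes and cubes -/

lemma memLp_restrict_of_continuous {X : Type*} [TopologicalSpace X] [MeasurableSpace X]
    [OpensMeasurableSpace X] {μ : Measure X} {p : ℝ≥0∞} {K S : Set X} (hK : IsCompact K)
    (hSK : S ⊆ K) (hS : MeasurableSet S) (hμ : μ S < ⊤) {f : X → ℝ} (hf : Continuous f) :
    MemLp f p (μ.restrict S) := by
  have : IsFiniteMeasure (μ.restrict S) := isFiniteMeasure_restrict.2 hμ.ne
  obtain ⟨C, hC⟩ := hK.exists_bound_of_continuousOn hf.continuousOn
  refine MemLp.of_bound hf.aestronglyMeasurable C ?_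
  filter_upwards [ae_restrict_mem hS] with x hx
  exact hC x (hSK hx)

section Box

variable {ι : Type*}

/-- The open axis-parallel box in Euclidean space with the given lower and upper bounds of the
coordinates. -/
def openBox (lo hi : ι → ℝ) : Set (EuclideanSpace ℝ ι) := {x | ∀ d, x d ∈ Ioo (lo d) (hi d)}

/-- The closed axis-parallel box in Euclidean space with the given lower and upper bounds of the
coordinates. -/
def closedBox (lo hi : ι → ℝ) : Set (EuclideanSpace ℝ ι) := {x | ∀ d, x d ∈ Icc (lo d) (hi d)}

/-- The open axis-parallel cube with lowest corner `a` and side length `s`. -/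
abbrev openCube (a : ι → ℝ) (s : ℝ) : Set (EuclideanSpace ℝ ι) := openBox a fun d => a d + s

/-- The closed axis-parallel cube with lowest corner `a` and side length `s`. -/
abbrev closedCube (a : ι → ℝ) (s : ℝ) : Set (EuclideanSpace ℝ ι) := closedBox a fun d => a d + s

lemma openBox_subset_closedBox (lo hi : ι → ℝ) : openBox lo hi ⊆ closedBox lo hi :=
  fun _ hx d => Ioo_subset_Icc_self (hx d)

lemma openBox_eq_preimage_pi (lo hi : ι → ℝ) :
    openBox lo hi = WithLp.ofLp ⁻¹' univ.pi fun d => Ioo (lo d) (hi d) := by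
  ext x; simp [openBox]

lemma closedBox_eq_preimage_pi (lo hi : ι → ℝ) :
    closedBox lo hi = WithLp.ofLp ⁻¹' univ.pi fun d => Icc (lo d) (hi d) := by
  ext x; simp [closedBox, Pi.le_def, forall_and]

lemma isOpen_openBox [Finite ι] (lo hi : ι → ℝ) : IsOpen (openBox lo hi) := by
  rw [openBox_eq_preimage_pi]
  exact (isOpen_set_pi finite_univ fun _ _ => isOpen_Ioo).preimage (PiLp.continuous_ofLp 2 _)

lemma isClosed_closedBox (lo hi : ι → ℝ) : IsClosed (closedBox lo hi) := by
  rw [closedBox_eq_preimage_pi]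
  exact (isClosed_set_pi fun _ _ => isClosed_Icc).preimage (PiLp.continuous_ofLp 2 _)

lemma closure_openBox {lo hi : ι → ℝ} (h : ∀ d, lo d < hi d) :
    closure (openBox lo hi) = closedBox lo hi := by
  have h_pi := (PiLp.homeomorph 2 fun _ : ι => ℝ).preimage_closure
    (univ.pi fun d => Ioo (lo d) (hi d))
  simp only [closure_pi_set, closure_Ioo (h _).ne] at h_pi
  rw [openBox_eq_preimage_pi, closedBox_eq_preimage_pi]
  exact h_pi.symm

lemma isCompact_closedBox (lo hi : ι → ℝ) : IsCompact (closedBox lo hi) := by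
  rw [closedBox_eq_preimage_pi]
  exact (PiLp.homeomorph 2 fun _ : ι => ℝ).isCompact_preimage.2
    (isCompact_univ_pi fun _ => isCompact_Icc)

lemma exists_le_of_disjoint_openBox {lo hi lo' hi' : ι → ℝ} (h : ∀ d, lo d < hi d)
    (h' : ∀ d, lo' d < hi' d) (h_disj : Disjoint (openBox lo hi) (openBox lo' hi')) :
    ∃ d, hi d ≤ lo' d ∨ hi' d ≤ lo d := by
  by_contra! h_overlap
  have h_lt : ∀ d, max (lo d) (lo' d) < min (hi d) (hi' d) := fun d =>
    max_lt (lt_min (h d) (h_overlap d).2) (lt_min (h_overlap d).1 (h' d))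
  choose x hx hx' using fun d => exists_between (h_lt d)
  exact h_disj.notMem_of_mem_left (a := WithLp.toLp 2 x)
    (fun d => ⟨(le_max_left _ _).trans_lt (hx d), (hx' d).trans_le (min_le_left _ _)⟩)
    (fun d => ⟨(le_max_right _ _).trans_lt (hx d), (hx' d).trans_le (min_le_right _ _)⟩)

lemma exists_openCube_min_subset {a b : ι → ℝ} {s t : ℝ}
    (h : (closedCube a s ∩ closedCube b t).Nonempty) :
    ∃ c, openCube c (min s t) ⊆ openCube b t ∩ openCube (fun d => a d - s) (3 * s) := by
  obtain ⟨x, hxa, hxb⟩ := h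
  refine ⟨fun d => max (b d) (a d - s), fun y hy => ⟨fun d => ?_, fun d => ?_⟩⟩ <;>
  · obtain ⟨h_lo, h_hi⟩ := hy d
    obtain ⟨h_b, h_a⟩ := max_lt_iff.1 h_lo
    have h_a' := hxa d
    have h_b' := hxb d
    simp only [mem_Icc, mem_Ioo] at h_a' h_b' h_hi ⊢
    refine ⟨by assumption, h_hi.trans_le ?_⟩
    rcases max_cases (b d) (a d - s) with ⟨h_max, _⟩ | ⟨h_max, _⟩ <;>
      rw [h_max] <;> linarith [min_le_left s t, min_le_right s t]

lemma closedBox_union_closedBox_mem_nhds [Finite ι] {lo hi lo' hi' : ι → ℝ} {d : ι}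
    {x : EuclideanSpace ℝ ι} (h : lo d < x d) (h' : x d < hi' d) (hx : x d = hi d)
    (hx' : x d = lo' d) (h_side : ∀ e ≠ d, x e ∈ Ioo (lo e) (hi e) ∩ Ioo (lo' e) (hi' e)) :
    closedBox lo hi ∪ closedBox lo' hi' ∈ 𝓝 x := by
  have h_continuous : ∀ e, ContinuousAt (fun y : EuclideanSpace ℝ ι => y e) x := fun e => by
    fun_prop
  have h_near : ∀ᶠ y in 𝓝 x, ∀ e, e ≠ d → y e ∈ Ioo (lo e) (hi e) ∩ Ioo (lo' e) (hi' e) :=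
    eventually_all.2 fun e => eventually_imp_distrib_left.2 fun he =>
      (h_continuous e).eventually ((isOpen_Ioo.inter isOpen_Ioo).mem_nhds (h_side e he))
  filter_upwards [h_near, (h_continuous d).eventually (Ioo_mem_nhds h h')] with y hy hyd
  rcases le_total (y d) (x d) with h_le | h_le
  · refine Or.inl fun e => ?_
    rcases eq_or_ne e d with rfl | he
    exacts [⟨hyd.1.le, h_le.trans_eq hx⟩, Ioo_subset_Icc_self (hy e he).1]
  · refine Or.inr fun e => ?_
    rcases eq_or_ne e d with rfl | he
    exacts [⟨hx'.symm.trans_le h_le, hyd.2.le⟩, Ioo_subset_Icc_self (hy e he).2]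

variable [Fintype ι]

lemma volume_openBox (lo hi : ι → ℝ) :
    volume (openBox lo hi) = ∏ d, ENNReal.ofReal (hi d - lo d) := by
  rw [openBox_eq_preimage_pi, (PiLp.volume_preserving_ofLp ι).measure_preimage
    (MeasurableSet.univ_pi fun _ => measurableSet_Ioo).nullMeasurableSet, Real.volume_pi_Ioo]

lemma volumeReal_openCube (a : ι → ℝ) {s : ℝ} (hs : 0 ≤ s) :
    volume.real (openCube a s) = s ^ Fintype.card ι := by
  simp [measureReal_def, volume_openBox, ENNReal.toReal_ofReal hs]

lemma volume_openBox_lt_top (lo hi : ι → ℝ) : volume (openBox lo hi) < ⊤ := by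
  rw [volume_openBox]
  exact ENNReal.prod_lt_top fun _ _ => ENNReal.ofReal_lt_top

instance isFiniteMeasure_restrict_openBox (lo hi : ι → ℝ) :
    IsFiniteMeasure (volume.restrict (openBox lo hi)) :=
  isFiniteMeasure_restrict.2 (volume_openBox_lt_top lo hi).ne

lemma memLp_openBox_of_continuous {lo hi : ι → ℝ} {f : EuclideanSpace ℝ ι → ℝ} (hf : Continuous f) :
    MemLp f 2 (volume.restrict (openBox lo hi)) :=
  memLp_restrict_of_continuous (isCompact_closedBox lo hi) (openBox_subset_closedBox lo hi)
    (isOpen_openBox lo hi).measurableSet (volume_openBox_lt_top lo hi) hf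

lemma dist_le_of_mem_closedCube {a : ι → ℝ} {s : ℝ} (hs : 0 ≤ s) {x y : EuclideanSpace ℝ ι}
    (hx : x ∈ closedCube a s) (hy : y ∈ closedCube a s) :
    dist x y ≤ √(Fintype.card ι) * s := by
  rw [EuclideanSpace.dist_eq, ← Real.sqrt_sq hs, ← Real.sqrt_mul (Nat.cast_nonneg _)]
  refine Real.sqrt_le_sqrt ?_
  calc ∑ d, dist (x d) (y d) ^ 2 ≤ ∑ _d : ι, s ^ 2 := Finset.sum_le_sum fun d _ =>
        pow_le_pow_left₀ dist_nonneg ((Real.dist_le_of_mem_Icc (hx d) (hy d)).trans_eq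
          (by ring)) 2
    _ = Fintype.card ι * s ^ 2 := by simp

open scoped Pointwise in
lemma setIntegral_openCube_comp_smul_sub (a : ι → ℝ) {s : ℝ} (hs : 0 < s)
    (F : EuclideanSpace ℝ ι → ℝ) :
    ∫ x in openCube a s, F (s⁻¹ • (x - WithLp.toLp 2 a))
      = s ^ Fintype.card ι * ∫ y in openCube 0 1, F y := by
  have h_shift : (fun x => x - WithLp.toLp 2 a) ⁻¹' openCube 0 s = openCube a s := by
    ext x
    simp [openBox, sub_lt_iff_lt_add']
  have h_scale : s⁻¹ • openCube (0 : ι → ℝ) s = openCube 0 1 := by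
    ext x
    simp [mem_inv_smul_set_iff₀ hs.ne', openBox, mul_pos_iff_of_pos_left hs,
      mul_lt_iff_lt_one_right hs]
  rw [← h_shift, (measurePreserving_sub_right volume (WithLp.toLp 2 a)).setIntegral_preimage_emb
      (MeasurableEquiv.subRight _).measurableEmbedding (fun x => F (s⁻¹ • x)),
    Measure.setIntegral_comp_smul_of_pos volume F _ (inv_pos.2 hs), h_scale]
  simp

/-- Each cube contains a cube of side `min s (t k)` inside the concentric threefold enlargement of
the given cube, so the sum of the volumes of these is at most `(3 s) ^ n`. -/
lemma sum_min_pow_card_le {κ : Type*} {T : Finset κ} {a : ι → ℝ} {s : ℝ} (hs : 0 ≤ s)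
    {b : κ → ι → ℝ} {t : κ → ℝ} (ht : ∀ k ∈ T, 0 ≤ t k)
    (h_disj : (T : Set κ).PairwiseDisjoint fun k => openCube (b k) (t k))
    (h_meet : ∀ k ∈ T, (closedCube a s ∩ closedCube (b k) (t k)).Nonempty) :
    ∑ k ∈ T, min s (t k) ^ Fintype.card ι ≤ (3 * s) ^ Fintype.card ι := by
  choose! c hc using fun k hk => exists_openCube_min_subset (h_meet k hk)
  have h_measurable : ∀ k ∈ T, MeasurableSet (openCube (c k) (min s (t k))) := fun k _ =>
    (isOpen_openBox _ _).measurableSet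
  have h_sub : ⋃ k ∈ T, openCube (c k) (min s (t k)) ⊆ openCube (fun d => a d - s) (3 * s) :=
    iUnion₂_subset fun k hk => (hc k hk).trans inter_subset_right
  calc ∑ k ∈ T, min s (t k) ^ Fintype.card ι
      = ∑ k ∈ T, volume.real (openCube (c k) (min s (t k))) := Finset.sum_congr rfl fun k hk =>
        (volumeReal_openCube _ (le_min hs (ht k hk))).symm
    _ = volume.real (⋃ k ∈ T, openCube (c k) (min s (t k))) :=
        (measureReal_biUnion_finset (h_disj.mono_on fun k hk => (hc k hk).trans inter_subset_left)
          h_measurable (fun k _ => (volume_openBox_lt_top _ _).ne)).symm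
    _ ≤ volume.real (openCube (fun d => a d - s) (3 * s)) :=
        measureReal_mono h_sub (volume_openBox_lt_top _ _).ne
    _ = (3 * s) ^ Fintype.card ι := volumeReal_openCube _ (by positivity)

end Box

/-! ### Polynomials in scaled coordinates -/

section ScaledPolynomial

variable {ι : Type*}

/-- The function `x ↦ Q ((x - a) / s)` of a polynomial `Q`, as an algebra homomorphism in `Q`; it
transports polynomials from the unit cube to the cube with corner `a` and side length `s`. -/
def scaledEval (a : ι → ℝ) (s : ℝ) : MvPolynomial ι ℝ →ₐ[ℝ] EuclideanSpace ℝ ι → ℝ :=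
  MvPolynomial.aeval fun d x => (x d - a d) / s

lemma scaledEval_X (a : ι → ℝ) (s : ℝ) (d : ι) :
    scaledEval a s (MvPolynomial.X d) = fun x => (x d - a d) / s :=
  MvPolynomial.aeval_X _ d

lemma scaledEval_apply (a : ι → ℝ) (s : ℝ) (Q : MvPolynomial ι ℝ) (x : EuclideanSpace ℝ ι) :
    scaledEval a s Q x = MvPolynomial.eval (fun d => (x d - a d) / s) Q := by
  induction Q using MvPolynomial.induction_on with
  | C c => simp [scaledEval]
  | add p q hp hq => simp [hp, hq]
  | mul_X p d hp => simp [hp, scaledEval_X]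

lemma scaledEval_eq_scaledEval_zero_one (a : ι → ℝ) (s : ℝ) (Q : MvPolynomial ι ℝ)
    (x : EuclideanSpace ℝ ι) :
    scaledEval a s Q x = scaledEval 0 1 Q (s⁻¹ • (x - WithLp.toLp 2 a)) := by
  simp [scaledEval_apply, div_eq_inv_mul]

lemma scaledEval_aeval_X (a : ι → ℝ) (s : ℝ) (d : ι) (P : Polynomial ℝ)
    (x : EuclideanSpace ℝ ι) :
    scaledEval a s (Polynomial.aeval (MvPolynomial.X d) P) x = P.eval ((x d - a d) / s) := by
  rw [scaledEval_apply, ← MvPolynomial.coe_aeval_eq_eval, RingHom.coe_coe,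
    ← Polynomial.aeval_algHom_apply]
  simp

lemma degreeOf_aeval_X_le [DecidableEq ι] (P : Polynomial ℝ) (d e : ι) :
    (Polynomial.aeval (MvPolynomial.X d : MvPolynomial ι ℝ) P).degreeOf e
      ≤ if e = d then P.natDegree else 0 := by
  rw [Polynomial.aeval_eq_sum_range]
  refine (MvPolynomial.degreeOf_sum_le _ _ _).trans (Finset.sup_le fun k hk => ?_)
  have h_le : k ≤ P.natDegree := Nat.lt_succ_iff.1 (Finset.mem_range.1 hk)
  rw [MvPolynomial.smul_eq_C_mul]
  refine (MvPolynomial.degreeOf_C_mul_le _ _ _).trans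
    ((MvPolynomial.degreeOf_pow_le _ _ _).trans ?_)
  rw [MvPolynomial.degreeOf_X]
  split_ifs <;> simp [h_le]

lemma prod_aeval_X_mem_restrictDegree [Fintype ι] {P : ι → Polynomial ℝ} {r : ℕ}
    (hP : ∀ d, (P d).natDegree ≤ r) :
    ∏ d, Polynomial.aeval (MvPolynomial.X d) (P d) ∈ MvPolynomial.restrictDegree ι ℝ r := by
  classical
  refine (MvPolynomial.mem_restrictDegree_iff_sup ι _ r).2 fun e => ?_
  rw [← MvPolynomial.degreeOf_def]
  calc _ ≤ ∑ d, if e = d then (P d).natDegree else 0 :=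
        (MvPolynomial.degreeOf_prod_le _ _ _).trans
          (Finset.sum_le_sum fun d _ => degreeOf_aeval_X_le (P d) d e)
    _ = (P e).natDegree := by simp
    _ ≤ r := hP e

/-- `D` is a local operator on functions which acts on polynomials as `L` and is homogeneous of
order `n`: passing to coordinates scaled by `s` produces the factor `s⁻ⁿ`. -/
def IsHomogeneousLocalOp (D : (EuclideanSpace ℝ ι → ℝ) → EuclideanSpace ℝ ι → ℝ)
    (L : MvPolynomial ι ℝ →ₗ[ℝ] MvPolynomial ι ℝ) (n : ℕ) : Prop :=
  ∀ ⦃O : Set (EuclideanSpace ℝ ι)⦄, IsOpen O → ∀ ⦃U : EuclideanSpace ℝ ι → ℝ⦄ ⦃a : ι → ℝ⦄ ⦃s : ℝ⦄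
    ⦃Q : MvPolynomial ι ℝ⦄, EqOn U (scaledEval a s Q) O →
      EqOn (D U) (s⁻¹ ^ n • scaledEval a s (L Q)) O

lemma isHomogeneousLocalOp_id : IsHomogeneousLocalOp (ι := ι) id LinearMap.id 0 :=
  fun _ _ _ _ _ _ h => by simpa using h

lemma IsHomogeneousLocalOp.comp {D D' : (EuclideanSpace ℝ ι → ℝ) → EuclideanSpace ℝ ι → ℝ}
    {L L' : MvPolynomial ι ℝ →ₗ[ℝ] MvPolynomial ι ℝ} {m n : ℕ} (hD : IsHomogeneousLocalOp D L m)
    (hD' : IsHomogeneousLocalOp D' L' n) :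
    IsHomogeneousLocalOp (fun U => D (D' U)) (L ∘ₗ L') (m + n) := fun O hO U a s Q h => by
  have h' : EqOn (D' U) (scaledEval a s (s⁻¹ ^ n • L' Q)) O := by simpa using hD' hO h
  simpa [smul_smul, pow_add] using hD hO h'

variable [Fintype ι]

lemma contDiff_scaledEval (a : ι → ℝ) (s : ℝ) (Q : MvPolynomial ι ℝ) :
    ContDiff ℝ ∞ (scaledEval a s Q) := by
  induction Q using MvPolynomial.induction_on with
  | C c =>
    rw [← MvPolynomial.algebraMap_eq, AlgHom.commutes]
    exact contDiff_const
  | add p q hp hq =>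
    rw [map_add]
    exact hp.add hq
  | mul_X p i hp =>
    rw [map_mul, scaledEval_X]
    exact hp.mul (((EuclideanSpace.proj i : EuclideanSpace ℝ ι →L[ℝ] ℝ).contDiff.sub
      contDiff_const).div_const s)

omit [Fintype ι] in
lemma continuous_scaledEval [Finite ι] (a : ι → ℝ) (s : ℝ) (Q : MvPolynomial ι ℝ) :
    Continuous (scaledEval a s Q) :=
  have := Fintype.ofFinite ι
  (contDiff_scaledEval a s Q).continuous

lemma hasFDerivAt_scaledEval (a : ι → ℝ) (s : ℝ) (Q : MvPolynomial ι ℝ)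
    (x : EuclideanSpace ℝ ι) :
    HasFDerivAt (scaledEval a s Q) (∑ d, scaledEval a s (MvPolynomial.pderiv d Q) x •
      s⁻¹ • (EuclideanSpace.proj d : EuclideanSpace ℝ ι →L[ℝ] ℝ)) x := by
  classical
  induction Q using MvPolynomial.induction_on with
  | C c =>
    rw [← MvPolynomial.algebraMap_eq, AlgHom.commutes]
    refine (hasFDerivAt_const c x).congr_fderiv ?_
    simp
  | add p q hp hq =>
    simpa only [map_add, Pi.add_apply, add_smul, Finset.sum_add_distrib] using hp.add hq
  | mul_X p i hp =>
    have hX : HasFDerivAt (scaledEval a s (MvPolynomial.X i))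
        (s⁻¹ • (EuclideanSpace.proj i : EuclideanSpace ℝ ι →L[ℝ] ℝ)) x := by
      simpa [scaledEval_X, div_eq_mul_inv] using
        ((EuclideanSpace.proj i : EuclideanSpace ℝ ι →L[ℝ] ℝ).hasFDerivAt.sub_const
          (a i)).mul_const s⁻¹
    rw [map_mul]
    refine (hp.mul hX).congr_fderiv ?_
    simp [Derivation.leibniz, MvPolynomial.pderiv_X, Pi.single_apply, add_smul,
      Finset.sum_add_distrib, Finset.smul_sum, mul_smul, apply_ite (scaledEval a s), ite_apply]

omit [Fintype ι] in
lemma fderiv_scaledEval_single [Finite ι] [DecidableEq ι] (a : ι → ℝ) (s : ℝ)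
    (Q : MvPolynomial ι ℝ) (d : ι) :
    (fun x => fderiv ℝ (scaledEval a s Q) x (EuclideanSpace.single d 1))
      = s⁻¹ • scaledEval a s (MvPolynomial.pderiv d Q) := by
  have := Fintype.ofFinite ι
  ext x
  rw [(hasFDerivAt_scaledEval a s Q x).fderiv]
  simp [mul_comm]

lemma laplacian_eq_sum_fderiv [DecidableEq ι] {f : EuclideanSpace ℝ ι → ℝ}
    {x : EuclideanSpace ℝ ι} (hf : ContDiffAt ℝ 2 f x) :
    Laplacian.laplacian f x = ∑ d, fderiv ℝ (fun y => fderiv ℝ f y (EuclideanSpace.single d 1)) x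
      (EuclideanSpace.single d 1) := by
  have hd : DifferentiableAt ℝ (fderiv ℝ f) x :=
    (hf.fderiv_right (m := 1) (by norm_num)).differentiableAt (by norm_num)
  rw [InnerProductSpace.laplacian_eq_iteratedFDeriv_orthonormalBasis f
    (EuclideanSpace.basisFun ι ℝ)]
  refine Finset.sum_congr rfl fun d _ => ?_
  rw [iteratedFDeriv_two_apply, fderiv_clm_apply hd (differentiableAt_const _)]
  simp

/-- The Laplace operator on polynomials. -/
def polyLaplacian : MvPolynomial ι ℝ →ₗ[ℝ] MvPolynomial ι ℝ :=
  ∑ d, (MvPolynomial.pderiv d).toLinearMap ∘ₗ (MvPolynomial.pderiv d).toLinearMap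

lemma laplacian_scaledEval (a : ι → ℝ) (s : ℝ) (Q : MvPolynomial ι ℝ) :
    Laplacian.laplacian (scaledEval a s Q) = s⁻¹ ^ 2 • scaledEval a s (polyLaplacian Q) := by
  classical
  ext x
  rw [laplacian_eq_sum_fderiv ((contDiff_scaledEval a s Q).contDiffAt.of_le (by norm_cast))]
  simp_rw [fderiv_scaledEval_single, ← map_smul, fun P d => congrFun
    (fderiv_scaledEval_single a s P d) x]
  simp [polyLaplacian, Finset.mul_sum, sq, mul_assoc]

omit [Fintype ι] in
lemma isHomogeneousLocalOp_fderiv_single [Finite ι] [DecidableEq ι] (d : ι) :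
    IsHomogeneousLocalOp (fun U x => fderiv ℝ U x (EuclideanSpace.single d 1))
      (MvPolynomial.pderiv d).toLinearMap 1 := fun O hO U a s Q h x hx => by
  dsimp only
  rw [(h.eventuallyEq_of_mem (hO.mem_nhds hx)).fderiv_eq, pow_one]
  exact congrFun (fderiv_scaledEval_single a s Q d) x

lemma isHomogeneousLocalOp_laplacian :
    IsHomogeneousLocalOp (ι := ι) Laplacian.laplacian polyLaplacian 2 := fun _ hO _ a s Q h x hx =>
  (InnerProductSpace.laplacian_congr_nhds (h.eventuallyEq_of_mem (hO.mem_nhds hx))).eq_of_nhds.trans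
    (congrFun (laplacian_scaledEval a s Q) x)

end ScaledPolynomial

/-! ### Inverse estimates -/

lemma norm_toLp_two_sq {α : Type*} [MeasurableSpace α] {μ : Measure α} {f : α → ℝ}
    (hf : MemLp f 2 μ) : ‖hf.toLp f‖ ^ 2 = ∫ x, f x ^ 2 ∂μ := by
  rw [← real_inner_self_eq_norm_sq, L2.inner_def]
  refine integral_congr_ae ?_
  filter_upwards [hf.coeFn_toLp] with x hx
  simp [hx, sq]

lemma exists_norm_le_mul_norm_of_injective {V E F : Type*} [AddCommGroup V] [Module ℝ V]
    [FiniteDimensional ℝ V] [NormedAddCommGroup E] [NormedSpace ℝ E] [NormedAddCommGroup F]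
    [NormedSpace ℝ F] {Φ : V →ₗ[ℝ] E} (hΦ : Function.Injective Φ) (G : V →ₗ[ℝ] F) :
    ∃ C : ℝ, ∀ x, ‖G x‖ ≤ C * ‖Φ x‖ := by
  let e := LinearEquiv.ofInjective Φ hΦ
  let T := (G ∘ₗ e.symm.toLinearMap).toContinuousLinearMap
  refine ⟨‖T‖, fun x => ?_⟩
  have h := T.le_opNorm (e x)
  rwa [show T (e x) = G x by simp [T]] at h

section InverseEstimate

variable {ι : Type*} [Fintype ι]

/-- Restriction of polynomial functions to the unit cube, as elements of `L²`. -/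
def unitCubeToLp : MvPolynomial ι ℝ →ₗ[ℝ] Lp ℝ 2 (volume.restrict (openCube (0 : ι → ℝ) 1)) where
  toFun Q := (memLp_openBox_of_continuous (continuous_scaledEval 0 1 Q)).toLp _
  map_add' P Q := by simp_rw [map_add]; rfl
  map_smul' c Q := by simp_rw [map_smul]; rfl

lemma unitCubeToLp_injective : Function.Injective (unitCubeToLp (ι := ι)) := by
  refine (injective_iff_map_eq_zero _).2 fun Q hQ => ?_
  have h_ae := (MemLp.toLp_eq_toLp_iff (memLp_openBox_of_continuous
    (continuous_scaledEval 0 1 Q)) MemLp.zero).1 (hQ.trans (MemLp.toLp_zero _).symm)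
  have h_eqOn := Measure.eqOn_open_of_ae_eq h_ae (isOpen_openBox _ _)
    (continuous_scaledEval 0 1 Q).continuousOn continuousOn_const
  refine MvPolynomial.funext_set (fun _ => Ioo (0 : ℝ) 1) (fun _ => Ioo_infinite one_pos)
    fun x hx => ?_
  simpa [scaledEval_apply] using
    h_eqOn (x := WithLp.toLp 2 x) fun d => by simpa using hx d (mem_univ d)

variable (F : Submodule ℝ (MvPolynomial ι ℝ)) [FiniteDimensional ℝ F]
  (L : MvPolynomial ι ℝ →ₗ[ℝ] MvPolynomial ι ℝ)

lemma exists_sq_scaledEval_le_unitCube : ∃ C : ℝ, 0 ≤ C ∧ ∀ Q ∈ F, ∀ y ∈ closedCube (0 : ι → ℝ) 1,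
    scaledEval 0 1 (L Q) y ^ 2 ≤ C * ∫ x in openCube 0 1, scaledEval 0 1 Q x ^ 2 := by
  have : CompactSpace (closedCube (0 : ι → ℝ) 1) :=
    isCompact_iff_compactSpace.1 (isCompact_closedBox _ _)
  let G : F →ₗ[ℝ] C(closedCube (0 : ι → ℝ) 1, ℝ) :=
    { toFun := fun Q => ⟨fun y => scaledEval 0 1 (L Q) y,
        (continuous_scaledEval 0 1 _).comp continuous_subtype_val⟩
      map_add' := fun P Q => by ext y; simp
      map_smul' := fun c Q => by ext y; simp }
  obtain ⟨C, h⟩ := exists_norm_le_mul_norm_of_injective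
    (Φ := unitCubeToLp ∘ₗ F.subtype) (unitCubeToLp_injective.comp F.injective_subtype) G
  refine ⟨C ^ 2, sq_nonneg C, fun Q hQ y hy => ?_⟩
  have h_sup : |scaledEval 0 1 (L Q) y| ≤ ‖G ⟨Q, hQ⟩‖ := (G ⟨Q, hQ⟩).norm_coe_le_norm ⟨y, hy⟩
  rw [← norm_toLp_two_sq (memLp_openBox_of_continuous (continuous_scaledEval 0 1 Q)), ← mul_pow,
    ← sq_abs]
  exact pow_le_pow_left₀ (abs_nonneg _) (h_sup.trans (h ⟨Q, hQ⟩)) 2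

lemma exists_sq_scaledEval_le : ∃ C : ℝ, 0 ≤ C ∧ ∀ Q ∈ F, ∀ (a : ι → ℝ) (s : ℝ), 0 < s →
    ∀ y ∈ closedCube a s, s ^ Fintype.card ι * scaledEval a s (L Q) y ^ 2
      ≤ C * ∫ x in openCube a s, scaledEval a s Q x ^ 2 := by
  obtain ⟨C, hC, h⟩ := exists_sq_scaledEval_le_unitCube F L
  refine ⟨C, hC, fun Q hQ a s hs y hy => ?_⟩
  have hy' : s⁻¹ • (y - WithLp.toLp 2 a) ∈ closedCube (0 : ι → ℝ) 1 := fun d => by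
    obtain ⟨h_lo, h_hi⟩ := hy d
    simp only [PiLp.smul_apply, PiLp.sub_apply, smul_eq_mul, Pi.zero_apply, zero_add,
      ← div_eq_inv_mul]
    exact ⟨div_nonneg (sub_nonneg.2 h_lo) hs.le, (div_le_one hs).2 (by linarith)⟩
  simp_rw [scaledEval_eq_scaledEval_zero_one a s,
    setIntegral_openCube_comp_smul_sub a hs fun x => scaledEval 0 1 Q x ^ 2]
  rw [mul_left_comm]
  exact mul_le_mul_of_nonneg_left (h Q hQ _ hy') (by positivity)

lemma exists_integral_sq_scaledEval_le : ∃ C : ℝ, 0 ≤ C ∧ ∀ Q ∈ F, ∀ (a : ι → ℝ) (s : ℝ), 0 < s →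
    ∫ x in openCube a s, scaledEval a s (L Q) x ^ 2
      ≤ C * ∫ x in openCube a s, scaledEval a s Q x ^ 2 := by
  obtain ⟨C, hC, h⟩ := exists_sq_scaledEval_le F L
  refine ⟨C, hC, fun Q hQ a s hs => ?_⟩
  set I := ∫ x in openCube a s, scaledEval a s Q x ^ 2
  calc ∫ x in openCube a s, scaledEval a s (L Q) x ^ 2
      ≤ ∫ _ in openCube a s, C * I / s ^ Fintype.card ι :=
        setIntegral_mono_on
          (memLp_openBox_of_continuous (continuous_scaledEval a s _)).integrable_sq
          (integrable_const _) (isOpen_openBox _ _).measurableSet fun x hx =>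
            (le_div_iff₀' (by positivity)).2 (h Q hQ a s hs x (openBox_subset_closedBox _ _ hx))
    _ = C * I := by
        rw [setIntegral_const, volumeReal_openCube a hs.le, smul_eq_mul,
          mul_div_cancel₀ _ (by positivity)]

end InverseEstimate

/-! ### Univariate B-splines -/

section BSpline

variable {ξ : ℤ → ℝ}

lemma bspline_eq_zero (hξ : Monotone ξ) (p : ℕ) (i : ℤ) {t : ℝ}
    (ht : t < ξ i ∨ ξ (i + p + 1) ≤ t) : bspline ξ p i t = 0 := by
  induction p generalizing i with
  | zero =>
    rw [Nat.cast_zero, add_zero] at ht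
    exact if_neg fun h => ht.elim h.1.not_gt h.2.not_ge
  | succ p ih =>
    have h_left : bspline ξ p i t = 0 := ih i (ht.imp_right (hξ (by lia)).trans)
    have h_right : bspline ξ p (i + 1) t = 0 :=
      ih (i + 1) (ht.imp (·.trans_le (hξ (by lia))) (hξ (by lia)).trans)
    rw [bspline, h_left, h_right, mul_zero, mul_zero, add_zero]

lemma bspline_nonneg (hξ : Monotone ξ) (p : ℕ) (i : ℤ) (t : ℝ) : 0 ≤ bspline ξ p i t := by
  induction p generalizing i with
  | zero => rw [bspline]; split_ifs <;> simp
  | succ p ih =>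
    by_cases ht : t < ξ i ∨ ξ (i + (p + 1 : ℕ) + 1) ≤ t
    · exact (bspline_eq_zero hξ _ i ht).ge
    · push Not at ht
      rw [show i + ((p + 1 : ℕ) : ℤ) + 1 = i + p + 2 by push_cast; ring] at ht
      exact add_nonneg
        (mul_nonneg (div_nonneg (sub_nonneg.2 ht.1) (sub_nonneg.2 (hξ (by lia)))) (ih i))
        (mul_nonneg (div_nonneg (sub_nonneg.2 ht.2.le) (sub_nonneg.2 (hξ (by lia)))) (ih _))

lemma bspline_pos (hξ : Monotone ξ) (p : ℕ) (i : ℤ) {t : ℝ} (ht : t ∉ range ξ)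
    (h_left : ξ i < t) (h_right : t < ξ (i + p + 1)) : 0 < bspline ξ p i t := by
  induction p generalizing i with
  | zero =>
    rw [Nat.cast_zero, add_zero] at h_right
    rw [bspline, if_pos ⟨h_left.le, h_right⟩]
    exact one_pos
  | succ p ih =>
    rw [show i + ((p + 1 : ℕ) : ℤ) + 1 = i + p + 2 by push_cast; ring] at h_right
    have h_left_width : 0 ≤ ξ (i + p + 1) - ξ i := sub_nonneg.2 (hξ (by lia))
    have h_right_width : 0 ≤ ξ (i + p + 2) - ξ (i + 1) := sub_nonneg.2 (hξ (by lia))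
    rcases lt_or_ge t (ξ (i + p + 1)) with h | h
    · exact add_pos_of_pos_of_nonneg
        (mul_pos (div_pos (by linarith) (by linarith)) (ih i h_left h))
        (mul_nonneg (div_nonneg (by linarith) h_right_width) (bspline_nonneg hξ _ _ _))
    · have h_next : ξ (i + 1) < t :=
        ((hξ (by lia)).trans h).lt_of_ne fun h_eq => ht ⟨_, h_eq⟩
      refine add_pos_of_nonneg_of_pos
        (mul_nonneg (div_nonneg (by linarith) h_left_width) (bspline_nonneg hξ _ _ _))
        (mul_pos (div_pos (by linarith) (by linarith)) (ih (i + 1) h_next ?_))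
      rwa [show i + 1 + (p : ℤ) + 1 = i + p + 2 by ring]

lemma exists_polynomial_eqOn_bspline {a b : ℝ} (hab : ∀ j, ξ j ≤ a ∨ b ≤ ξ j) (p : ℕ) (i : ℤ) :
    ∃ P : Polynomial ℝ, P.natDegree ≤ p ∧ EqOn (bspline ξ p i) (P.eval ·) (Ioo a b) := by
  induction p generalizing i with
  | zero =>
    by_cases h : ξ i ≤ a ∧ b ≤ ξ (i + 1)
    · refine ⟨1, by simp, fun t ht => ?_⟩
      simp [bspline, h.1.trans ht.1.le, ht.2.trans_le h.2]
    · refine ⟨0, by simp, fun t ht => ?_⟩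
      refine (if_neg fun h_mem => h ?_).trans Polynomial.eval_zero.symm
      exact ⟨(hab i).resolve_right fun h' => by linarith [ht.2, h_mem.1],
        (hab (i + 1)).resolve_left fun h' => by linarith [ht.1, h_mem.2]⟩
  | succ p ih =>
    obtain ⟨P, hP, hP_eq⟩ := ih i
    obtain ⟨Q, hQ, hQ_eq⟩ := ih (i + 1)
    refine ⟨Polynomial.C (1 / (ξ (i + p + 1) - ξ i)) * ((Polynomial.X - Polynomial.C (ξ i)) * P)
      + Polynomial.C (1 / (ξ (i + p + 2) - ξ (i + 1))) *
        ((Polynomial.C (ξ (i + p + 2)) - Polynomial.X) * Q), ?_, fun t ht => ?_⟩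
    · have h_deg : ∀ (c : ℝ) (l R : Polynomial ℝ), l.natDegree ≤ 1 → R.natDegree ≤ p →
          (Polynomial.C c * (l * R)).natDegree ≤ p + 1 := fun c l R hl hR =>
        (Polynomial.natDegree_C_mul_le _ _).trans (Polynomial.natDegree_mul_le.trans (by lia))
      exact Polynomial.natDegree_add_le_of_degree_le
        (h_deg _ _ _ (Polynomial.natDegree_X_sub_C_le _) hP)
        (h_deg _ _ _ ((Polynomial.natDegree_sub_le _ _).trans (by simp)) hQ)
    · rw [bspline, hP_eq ht, hQ_eq ht]
      simp only [Polynomial.eval_add, Polynomial.eval_mul, Polynomial.eval_sub, Polynomial.eval_C,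
        Polynomial.eval_X]
      ring

end BSpline

/-! ### Knot sequences -/

lemma ncard_preimage_le_ncard_preimage {ι α : Type*} {ξ ζ : ι → α} {S : Set α}
    (hξ : (ξ ⁻¹' S).Finite) (hζ : (ζ ⁻¹' S).Finite)
    (h : ∀ t ∈ S, {i | ξ i = t}.ncard ≤ {i | ζ i = t}.ncard) :
    (ξ ⁻¹' S).ncard ≤ (ζ ⁻¹' S).ncard := by
  let _ := Classical.decEq α
  have h_fiber : ∀ {f : ι → α} (hf : (f ⁻¹' S).Finite), ∀ t ∈ S,
      ((hf.toFinset).filter fun i => f i = t).card = {i | f i = t}.ncard := fun hf t ht => by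
    rw [← ncard_coe_finset]
    congr 1
    ext i
    simp only [Finset.coe_filter, Finite.mem_toFinset, mem_preimage, mem_ofPred_eq,
      and_iff_right_iff_imp]
    rintro rfl
    exact ht
  have h_image : ∀ t ∈ hξ.toFinset.image ξ, t ∈ S := by simp
  rw [ncard_eq_toFinset_card _ hξ, ncard_eq_toFinset_card _ hζ,
    Finset.card_eq_sum_card_image ξ hξ.toFinset]
  calc ∑ t ∈ hξ.toFinset.image ξ, (hξ.toFinset.filter fun i => ξ i = t).card
      ≤ ∑ t ∈ hξ.toFinset.image ξ, (hζ.toFinset.filter fun i => ζ i = t).card := by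
        refine Finset.sum_le_sum fun t ht => ?_
        rw [h_fiber hξ t (h_image t ht), h_fiber hζ t (h_image t ht)]
        exact h t (h_image t ht)
    _ ≤ hζ.toFinset.card := by
        rw [Finset.sum_card_fiberwise_eq_card_filter]
        exact Finset.card_filter_le _ _

section KnotSequence

variable {α : Type*} [LinearOrder α] {ξ ζ : ℤ → α}

lemma exists_isLast_int {P : ℤ → Prop} (hP : ∃ i, P i) (h_bdd : ∃ j, ∀ i, P i → i ≤ j) :
    ∃ i, P i ∧ ¬ P (i + 1) := by
  obtain ⟨i, hi, h_max⟩ := Int.exists_greatest_of_bdd h_bdd hP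
  exact ⟨i, hi, fun h => by linarith [h_max _ h]⟩

variable (hξ : Monotone ξ) (h_below : ¬ BddBelow (range ξ)) (h_above : ¬ BddAbove (range ξ))

include hξ h_below h_above

lemma exists_knot_lt_le (t : α) : ∃ i, ξ i < t ∧ t ≤ ξ (i + 1) := by
  obtain ⟨_, ⟨i, rfl⟩, hi⟩ := not_bddBelow_iff.1 h_below t
  obtain ⟨_, ⟨j, rfl⟩, hj⟩ := not_bddAbove_iff.1 h_above t
  simpa using exists_isLast_int (P := fun i => ξ i < t) ⟨i, hi⟩
    ⟨j, fun k hk => (hξ.reflect_lt (hk.trans hj)).le⟩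

lemma exists_knot_le_lt (t : α) : ∃ i, ξ i ≤ t ∧ t < ξ (i + 1) := by
  obtain ⟨_, ⟨i, rfl⟩, hi⟩ := not_bddBelow_iff.1 h_below t
  obtain ⟨_, ⟨j, rfl⟩, hj⟩ := not_bddAbove_iff.1 h_above t
  simpa using exists_isLast_int (P := fun i => ξ i ≤ t) ⟨i, hi.le⟩
    ⟨j, fun k hk => (hξ.reflect_lt (hk.trans_lt hj)).le⟩

lemma finite_preimage_Icc_knot (a b : α) : (ξ ⁻¹' Icc a b).Finite := by
  obtain ⟨_, ⟨i, rfl⟩, hi⟩ := not_bddBelow_iff.1 h_below a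
  obtain ⟨_, ⟨j, rfl⟩, hj⟩ := not_bddAbove_iff.1 h_above b
  exact (finite_Icc i j).subset fun k hk =>
    ⟨(hξ.reflect_lt (hi.trans_le hk.1)).le, (hξ.reflect_lt (hk.2.trans_lt hj)).le⟩

lemma exists_knot_lt_lt {r : ℕ} {t : α} (ht : {i | ξ i = t}.ncard ≤ r) :
    ∃ i, ξ i < t ∧ t < ξ (i + r + 1) := by
  obtain ⟨i, hi, hi'⟩ := exists_knot_lt_le hξ h_below h_above t
  refine ⟨i, hi, lt_of_not_ge fun h => ?_⟩
  have h_eq : ((Finset.Ioc i (i + r + 1) : Finset ℤ) : Set ℤ) ⊆ {i | ξ i = t} := fun j hj => by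
    rw [Finset.coe_Ioc] at hj
    exact le_antisymm ((hξ hj.2).trans h) (hi'.trans (hξ (by linarith [hj.1])))
  have h_card := ncard_le_ncard h_eq ((finite_preimage_Icc_knot hξ h_below h_above t t).subset
    fun j (hj : ξ j = t) => by simp [hj])
  rw [ncard_coe_finset, Int.card_Ioc] at h_card
  lia

lemma exists_knot_interval_superset (hζ : Monotone ζ)
    (h_mult : ∀ t, {i | ξ i = t}.ncard ≤ {i | ζ i = t}.ncard) (r : ℕ) (k : ℤ) :
    ∃ i, ξ i ≤ ζ k ∧ ζ (k + r + 1) ≤ ξ (i + r + 1) := by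
  obtain ⟨i, hi, hi'⟩ := exists_knot_le_lt hξ h_below h_above (ζ k)
  refine ⟨i, hi, le_of_not_gt fun h => ?_⟩
  set S := Ioo (ζ k) (ζ (k + r + 1))
  have hξS : ((Finset.Ioc i (i + r + 1) : Finset ℤ) : Set ℤ) ⊆ ξ ⁻¹' S := fun j hj => by
    rw [Finset.coe_Ioc] at hj
    exact ⟨hi'.trans_le (hξ (by linarith [hj.1])), (hξ hj.2).trans_lt h⟩
  have hζS : ζ ⁻¹' S ⊆ ((Finset.Ioo k (k + r + 1) : Finset ℤ) : Set ℤ) := fun j hj => by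
    rw [Finset.coe_Ioo]
    exact ⟨hζ.reflect_lt hj.1, hζ.reflect_lt hj.2⟩
  have hξ_fin : (ξ ⁻¹' S).Finite := (finite_preimage_Icc_knot hξ h_below h_above _ _).subset
    (preimage_mono Ioo_subset_Icc_self)
  have hζ_fin : (ζ ⁻¹' S).Finite := (Finset.finite_toSet _).subset hζS
  have h_card := (ncard_le_ncard hξS hξ_fin).trans
    ((ncard_preimage_le_ncard_preimage hξ_fin hζ_fin fun t _ => h_mult t).trans
      (ncard_le_ncard hζS (Finset.finite_toSet _)))
  rw [ncard_coe_finset, ncard_coe_finset, Int.card_Ioc, Int.card_Ioo] at h_card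
  lia

end KnotSequence

/-! ### Geometry of hierarchical partitions -/

namespace HierMesh

variable (M : HierMesh)

/-- The lowest corner of a square. -/
def lower (τ : CellIdx) (d : Fin 2) : ℝ := M.grid d τ.1 (τ.2 d)

/-- The side length of a square. -/
def side (τ : CellIdx) : ℝ := M.h / 2 ^ τ.1

lemma side_pos (τ : CellIdx) : 0 < M.side τ := div_pos M.h_pos (by positivity)

lemma grid_strictMono (d : Fin 2) (ℓ : ℕ) : StrictMono (M.grid d ℓ) := fun j k h => by
  have := M.h_pos
  simp only [grid]
  gcongr

lemma tendsto_grid_atTop (d : Fin 2) (ℓ : ℕ) : Tendsto (M.grid d ℓ) atTop atTop :=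
  tendsto_atTop_add_const_left _ _
    ((tendsto_intCast_atTop_atTop.const_mul_atTop M.h_pos).atTop_div_const (by positivity))

lemma tendsto_grid_atBot (d : Fin 2) (ℓ : ℕ) : Tendsto (M.grid d ℓ) atBot atBot :=
  tendsto_atBot_add_const_left _ _
    (((tendsto_intCast_atBot_iff.2 tendsto_id).const_mul_atBot M.h_pos).atBot_div_const
      (by positivity))

lemma grid_succ_two_mul (d : Fin 2) (ℓ : ℕ) (k : ℤ) : M.grid d (ℓ + 1) (2 * k) = M.grid d ℓ k := by
  simp only [grid, pow_succ]
  push_cast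
  field_simp

lemma grid_mem_range_of_le (d : Fin 2) {m ℓ : ℕ} (h : m ≤ ℓ) (k : ℤ) :
    M.grid d m k ∈ range (M.grid d ℓ) := by
  induction ℓ, h using Nat.le_induction with
  | base => exact mem_range_self k
  | succ n _ ih =>
    obtain ⟨j, hj⟩ := ih
    exact ⟨2 * j, by rw [grid_succ_two_mul, hj]⟩

lemma grid_le_or_le (d : Fin 2) {m ℓ : ℕ} (h : m ≤ ℓ) (j k : ℤ) :
    M.grid d m j ≤ M.grid d ℓ k ∨ M.grid d ℓ (k + 1) ≤ M.grid d m j := by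
  obtain ⟨i, hi⟩ := M.grid_mem_range_of_le d h j
  rw [← hi, (M.grid_strictMono d ℓ).le_iff_le, (M.grid_strictMono d ℓ).le_iff_le]
  lia

lemma lower_add_side (τ : CellIdx) (d : Fin 2) :
    M.lower τ d + M.side τ = M.grid d τ.1 (τ.2 d + 1) := by
  simp only [lower, side, grid]
  push_cast
  ring

lemma cell_eq_openCube (τ : CellIdx) : M.cell τ = openCube (M.lower τ) (M.side τ) := by
  simp only [openCube, lower_add_side]
  rfl

lemma closedCell_eq_closedCube (τ : CellIdx) :
    M.closedCell τ = closedCube (M.lower τ) (M.side τ) := by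
  simp only [closedCube, lower_add_side]
  rfl

lemma mem_vertices {τ : CellIdx} {x : Plane} :
    x ∈ M.vertices τ ↔ ∀ d, x d = M.lower τ d ∨ x d = M.lower τ d + M.side τ := by
  simp only [lower_add_side]
  rfl

lemma isOpen_cell (τ : CellIdx) : IsOpen (M.cell τ) := isOpen_openBox _ _

lemma isClosed_closedCell (τ : CellIdx) : IsClosed (M.closedCell τ) := isClosed_closedBox _ _

lemma isCompact_closedCell (τ : CellIdx) : IsCompact (M.closedCell τ) := isCompact_closedBox _ _

lemma cell_subset_closedCell (τ : CellIdx) : M.cell τ ⊆ M.closedCell τ :=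
  openBox_subset_closedBox _ _

lemma closure_cell (τ : CellIdx) : closure (M.cell τ) = M.closedCell τ :=
  closure_openBox fun d => M.grid_strictMono d τ.1 (lt_add_one _)

lemma cell_nonempty (τ : CellIdx) : (M.cell τ).Nonempty := by
  rw [← closure_nonempty_iff, closure_cell]
  exact ⟨WithLp.toLp 2 (M.lower τ), fun d => ⟨le_rfl, (M.grid_strictMono d τ.1).monotone (by lia)⟩⟩

lemma cellSize_le (τ : CellIdx) : M.cellSize τ ≤ √2 * M.side τ := by
  refine Metric.diam_le_of_forall_dist_le (by have := M.side_pos τ; positivity) fun x hx y hy => ?_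
  have h_mem := M.cell_subset_closedCell τ
  rw [closedCell_eq_closedCube] at h_mem
  simpa using dist_le_of_mem_closedCube (M.side_pos τ).le (h_mem hx) (h_mem hy)

lemma mem_cells {τ : CellIdx} : τ ∈ M.cells ↔
    τ.1 ≤ M.depth ∧ τ.2 ∈ levelIdx M.init M.refined τ.1 ∧ τ.2 ∉ M.refined τ.1 := by
  simp only [cells, Finset.mem_biUnion, Finset.mem_range, Finset.mem_image, Finset.mem_sdiff]
  constructor
  · rintro ⟨ℓ, hℓ, k, hk, rfl⟩
    exact ⟨Nat.lt_succ_iff.1 hℓ, hk⟩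
  · rintro ⟨h_depth, h⟩
    exact ⟨τ.1, Nat.lt_succ_iff.2 h_depth, τ.2, h, rfl⟩

lemma exists_refined_of_mem_levelIdx_succ {ℓ : ℕ} {k : Fin 2 → ℤ}
    (hk : k ∈ levelIdx M.init M.refined (ℓ + 1)) :
    ∃ j ∈ M.refined ℓ, M.cell (ℓ + 1, k) ⊆ M.cell (ℓ, j) := by
  simp only [levelIdx, childIdx, Finset.mem_biUnion, Fintype.mem_piFinset, Finset.mem_insert,
    Finset.mem_singleton] at hk
  obtain ⟨j, hj, hk⟩ := hk
  refine ⟨j, hj, fun x hx d => Ioo_subset_Ioo ?_ ?_ (hx d)⟩ <;>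
  · rw [← M.grid_succ_two_mul d ℓ, (M.grid_strictMono d _).le_iff_le]
    have := hk d
    lia

lemma exists_refined_of_lt {ℓ m : ℕ} (h : ℓ < m) {k : Fin 2 → ℤ}
    (hk : k ∈ levelIdx M.init M.refined m) :
    ∃ j ∈ M.refined ℓ, M.cell (m, k) ⊆ M.cell (ℓ, j) := by
  induction m, h using Nat.le_induction generalizing k with
  | base => exact M.exists_refined_of_mem_levelIdx_succ hk
  | succ n _ ih =>
    obtain ⟨i, hi, h_sub⟩ := M.exists_refined_of_mem_levelIdx_succ hk
    obtain ⟨j, hj, h_sub'⟩ := ih (M.refined_subset n hi)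
    exact ⟨j, hj, h_sub.trans h_sub'⟩

lemma closedCell_subset_subdomain_zero {τ : CellIdx} (hτ : τ.2 ∈ levelIdx M.init M.refined τ.1) :
    M.closedCell τ ⊆ M.subdomain 0 := by
  obtain ⟨ℓ, k⟩ := τ
  rcases Nat.eq_zero_or_pos ℓ with rfl | hℓ
  · exact subset_biUnion_of_mem (u := fun k => M.closedCell (0, k)) hτ
  · obtain ⟨j, hj, h_sub⟩ := M.exists_refined_of_lt hℓ hτ
    have h_closed := closure_mono h_sub
    rw [closure_cell, closure_cell] at h_closed
    exact h_closed.trans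
      (subset_biUnion_of_mem (u := fun k => M.closedCell (0, k)) (M.refined_subset 0 hj))

lemma cell_subset_dom {τ : CellIdx} (hτ : τ ∈ M.cells) : M.cell τ ⊆ M.dom :=
  interior_maximal ((M.cell_subset_closedCell τ).trans
    (M.closedCell_subset_subdomain_zero (M.mem_cells.1 hτ).2.1)) (M.isOpen_cell τ)

lemma disjoint_cell_of_ne (ℓ : ℕ) {j k : Fin 2 → ℤ} (h : j ≠ k) :
    Disjoint (M.cell (ℓ, j)) (M.cell (ℓ, k)) := by
  refine disjoint_left.2 fun x hj hk => h (funext fun d => ?_)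
  have h_jk := (M.grid_strictMono d ℓ).lt_iff_lt.1 ((hj d).1.trans (hk d).2)
  have h_kj := (M.grid_strictMono d ℓ).lt_iff_lt.1 ((hk d).1.trans (hj d).2)
  lia

lemma disjoint_cell_of_le {τ τ' : CellIdx} (hτ : τ ∈ M.cells)
    (hτ' : τ'.2 ∈ levelIdx M.init M.refined τ'.1) (h_le : τ.1 ≤ τ'.1) (h_ne : τ' ≠ τ) :
    Disjoint (M.cell τ) (M.cell τ') := by
  obtain ⟨ℓ, k⟩ := τ
  obtain ⟨m, k'⟩ := τ'
  rcases h_le.eq_or_lt with rfl | h_lt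
  · exact M.disjoint_cell_of_ne ℓ fun h => h_ne (by rw [h])
  · obtain ⟨j, hj, h_sub⟩ := M.exists_refined_of_lt h_lt hτ'
    have h_kj : k ≠ j := by
      rintro rfl
      exact (M.mem_cells.1 hτ).2.2 hj
    exact (M.disjoint_cell_of_ne ℓ h_kj).mono_right h_sub

lemma pairwiseDisjoint_cell : (M.cells : Set CellIdx).PairwiseDisjoint M.cell := by
  intro τ hτ τ' hτ' h_ne
  rcases le_total τ.1 τ'.1 with h | h
  · exact M.disjoint_cell_of_le hτ (M.mem_cells.1 hτ').2.1 h h_ne.symm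
  · exact (M.disjoint_cell_of_le hτ' (M.mem_cells.1 hτ).2.1 h h_ne).symm

lemma exists_separating_line {τ τ' : CellIdx} (hτ : τ ∈ M.cells) (hτ' : τ' ∈ M.cells)
    (h_ne : τ ≠ τ') : ∃ d,
      M.lower τ d + M.side τ ≤ M.lower τ' d ∨ M.lower τ' d + M.side τ' ≤ M.lower τ d := by
  have h_disj := M.pairwiseDisjoint_cell hτ hτ' h_ne
  simp only [Function.onFun, cell_eq_openCube] at h_disj
  exact exists_le_of_disjoint_openBox (fun d => by linarith [M.side_pos τ])
    (fun d => by linarith [M.side_pos τ']) h_disj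

lemma disjoint_cell_subdomain {τ : CellIdx} (hτ : τ ∈ M.cells) {m : ℕ} (h : τ.1 < m) :
    Disjoint (M.cell τ) (M.subdomain m) := by
  refine disjoint_iUnion₂_right.2 fun k hk => ?_
  rw [← closure_cell]
  exact (M.disjoint_cell_of_le hτ hk h.le fun h_eq => h.ne (by rw [← h_eq])).closure_right
    (M.isOpen_cell τ)

lemma subdomain_eq_empty {m : ℕ} (h : M.depth < m) : M.subdomain m = ∅ := by
  obtain ⟨n, rfl⟩ : ∃ n, m = n + 1 := ⟨m - 1, by lia⟩
  simp [subdomain, levelIdx, childIdx, M.refined_eq_empty n (by lia)]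

/-! ### Edges -/

lemma edge_comm (τ τ' : CellIdx) : M.edge τ τ' = M.edge τ' τ := by
  rw [edge, edge, inter_comm, union_comm]

lemma edge_subset_left (τ τ' : CellIdx) : M.edge τ τ' ⊆ M.closedCell τ := fun _ hx => hx.1.1

lemma edge_subset_right (τ τ' : CellIdx) : M.edge τ τ' ⊆ M.closedCell τ' := fun _ hx => hx.1.2

lemma isClosed_vertices (τ : CellIdx) : IsClosed (M.vertices τ) := by
  simp only [vertices, ofPred_forall, ofPred_or]
  exact isClosed_iInter fun d => (isClosed_eq (by fun_prop) continuous_const).union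
    (isClosed_eq (by fun_prop) continuous_const)

lemma measurableSet_edge (τ τ' : CellIdx) : MeasurableSet (M.edge τ τ') :=
  ((M.isClosed_closedCell τ).inter (M.isClosed_closedCell τ')).measurableSet.diff
    ((M.isClosed_vertices τ).union (M.isClosed_vertices τ')).measurableSet

variable {M}

lemma mem_Ioo_of_mem_closedCell_of_notMem_vertices {τ : CellIdx} {x : Plane} {d e : Fin 2}
    (hx : x ∈ M.closedCell τ) (hx' : x ∉ M.vertices τ)
    (hd : x d = M.lower τ d ∨ x d = M.lower τ d + M.side τ) (he : e ≠ d) :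
    x e ∈ Ioo (M.lower τ e) (M.lower τ e + M.side τ) := by
  rw [closedCell_eq_closedCube] at hx
  refine ⟨(hx e).1.lt_of_ne fun h => ?_, (hx e).2.lt_of_ne fun h => ?_⟩ <;>
  · refine hx' (M.mem_vertices.2 fun d' => ?_)
    rcases eq_or_ne d' d with rfl | h_ne
    · exact hd
    · obtain rfl : d' = e := by lia
      tauto

lemma apply_eq_of_mem_edge {τ τ' : CellIdx} {d : Fin 2} {x : Plane}
    (h : M.lower τ d + M.side τ ≤ M.lower τ' d) (hx : x ∈ M.edge τ τ') :
    x d = M.lower τ d + M.side τ ∧ x d = M.lower τ' d := by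
  have h_left := M.edge_subset_left _ _ hx
  have h_right := M.edge_subset_right _ _ hx
  rw [closedCell_eq_closedCube] at h_left h_right
  have h_upper : x d ≤ M.lower τ d + M.side τ := (h_left d).2
  have h_lower : M.lower τ' d ≤ x d := (h_right d).1
  exact ⟨by linarith, by linarith⟩

lemma exists_forall_mem_edge_apply_eq {τ τ' : CellIdx} (hτ : τ ∈ M.cells) (hτ' : τ' ∈ M.cells)
    (h_ne : τ ≠ τ') : ∃ d t, ∀ x ∈ M.edge τ τ', x d = t := by
  obtain ⟨d, hd | hd⟩ := M.exists_separating_line hτ hτ' h_ne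
  · exact ⟨d, _, fun x hx => (apply_eq_of_mem_edge hd hx).1⟩
  · exact ⟨d, _, fun x hx => (apply_eq_of_mem_edge hd (M.edge_comm τ τ' ▸ hx)).1⟩

lemma edge_subset_dom_of_le {τ τ' : CellIdx} (hτ : τ ∈ M.cells) (hτ' : τ' ∈ M.cells) {d : Fin 2}
    (h : M.lower τ d + M.side τ ≤ M.lower τ' d) : M.edge τ τ' ⊆ M.dom := by
  intro x hx
  obtain ⟨h_upper, h_lower⟩ := apply_eq_of_mem_edge h hx
  have h_not_vertex := not_or.1 hx.2
  have h_nhds : M.closedCell τ ∪ M.closedCell τ' ∈ 𝓝 x := by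
    rw [closedCell_eq_closedCube, closedCell_eq_closedCube]
    exact closedBox_union_closedBox_mem_nhds (by linarith [M.side_pos τ])
      (by linarith [M.side_pos τ']) h_upper h_lower fun e he =>
        ⟨mem_Ioo_of_mem_closedCell_of_notMem_vertices hx.1.1 h_not_vertex.1 (Or.inr h_upper) he,
          mem_Ioo_of_mem_closedCell_of_notMem_vertices hx.1.2 h_not_vertex.2 (Or.inl h_lower) he⟩
  exact mem_interior_iff_mem_nhds.2 (mem_of_superset h_nhds (union_subset
    (M.closedCell_subset_subdomain_zero (M.mem_cells.1 hτ).2.1)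
    (M.closedCell_subset_subdomain_zero (M.mem_cells.1 hτ').2.1)))

lemma edge_subset_dom {τ τ' : CellIdx} (hτ : τ ∈ M.cells) (hτ' : τ' ∈ M.cells) (h_ne : τ ≠ τ') :
    M.edge τ τ' ⊆ M.dom := by
  obtain ⟨d, hd | hd⟩ := M.exists_separating_line hτ hτ' h_ne
  · exact edge_subset_dom_of_le hτ hτ' hd
  · exact M.edge_comm τ τ' ▸ edge_subset_dom_of_le hτ' hτ hd

lemma mem_neighbors {τ τ' : CellIdx} :
    τ' ∈ M.neighbors τ ↔ τ' ∈ M.cells ∧ τ' ≠ τ ∧ (M.edge τ τ').Nonempty := by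
  simp [neighbors]

end HierMesh

lemma exists_isometry_image_Icc_superset {a : Fin 2 → ℝ} {s : ℝ} {S : Set Plane}
    (hS : S ⊆ closedCube a s) {d : Fin 2} {t : ℝ} (hd : ∀ x ∈ S, x d = t) :
    ∃ φ : ℝ → Plane, Isometry φ ∧ ∃ b, S ⊆ φ '' Icc b (b + s) := by
  refine ⟨fun u => WithLp.toLp 2 fun e => if e = d then t else u,
    Isometry.of_dist_eq fun u v => ?_, a (1 - d), fun x hx => ⟨x (1 - d), hS hx (1 - d), ?_⟩⟩
  · rw [EuclideanSpace.dist_eq, Fin.sum_univ_two]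
    fin_cases d <;> simp [Real.sqrt_sq]
  · ext e
    have := hd x hx
    fin_cases d <;> fin_cases e <;> simp_all

lemma diam_le_and_hausdorffMeasure_le {a : Fin 2 → ℝ} {s : ℝ} (hs : 0 ≤ s) {S : Set Plane}
    (hS : S ⊆ closedCube a s) {d : Fin 2} {t : ℝ} (hd : ∀ x ∈ S, x d = t) :
    Metric.diam S ≤ s ∧ Measure.hausdorffMeasure 1 S ≤ ENNReal.ofReal s := by
  obtain ⟨φ, hφ, b, hb⟩ := exists_isometry_image_Icc_superset hS hd
  constructor
  · refine (Metric.diam_mono hb (isCompact_Icc.image hφ.continuous).isBounded).trans_eq ?_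
    rw [hφ.diam_image, Real.diam_Icc (le_add_of_nonneg_right hs), add_sub_cancel_left]
  · refine (measure_mono hb).trans_eq ?_
    rw [hφ.hausdorffMeasure_image (Or.inl zero_le_one), hausdorffMeasure_real, Real.volume_Icc,
      add_sub_cancel_left]

namespace HierMesh

variable {M : HierMesh}

lemma diam_and_hausdorffMeasure_edge_le {τ τ' : CellIdx} (hτ : τ ∈ M.cells) (hτ' : τ' ∈ M.cells)
    (h_ne : τ ≠ τ') :
    Metric.diam (M.edge τ τ') ≤ min (M.side τ) (M.side τ') ∧
      Measure.hausdorffMeasure 1 (M.edge τ τ') ≤ ENNReal.ofReal (min (M.side τ) (M.side τ')) := by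
  obtain ⟨d, t, hd⟩ := exists_forall_mem_edge_apply_eq hτ hτ' h_ne
  have h_left := diam_le_and_hausdorffMeasure_le (M.side_pos τ).le
    (M.closedCell_eq_closedCube τ ▸ M.edge_subset_left τ τ') hd
  have h_right := diam_le_and_hausdorffMeasure_le (M.side_pos τ').le
    (M.closedCell_eq_closedCube τ' ▸ M.edge_subset_right τ τ') hd
  exact ⟨le_min h_left.1 h_right.1, by rw [ENNReal.ofReal_min]; exact le_min h_left.2 h_right.2⟩

lemma sum_neighbors_min_side_sq_le (τ : CellIdx) :
    ∑ τ' ∈ M.neighbors τ, min (M.side τ) (M.side τ') ^ 2 ≤ 9 * M.side τ ^ 2 := by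
  have h_disj : (M.neighbors τ : Set CellIdx).PairwiseDisjoint
      fun τ' => openCube (M.lower τ') (M.side τ') := by
    simp only [← cell_eq_openCube]
    exact M.pairwiseDisjoint_cell.subset fun τ' hτ' => (mem_neighbors.1 hτ').1
  have h_meet : ∀ τ' ∈ M.neighbors τ,
      (closedCube (M.lower τ) (M.side τ) ∩ closedCube (M.lower τ') (M.side τ')).Nonempty := by
    simp only [← closedCell_eq_closedCube]
    exact fun τ' hτ' => (mem_neighbors.1 hτ').2.2.mono sdiff_subset
  calc ∑ τ' ∈ M.neighbors τ, min (M.side τ) (M.side τ') ^ 2 ≤ (3 * M.side τ) ^ 2 := by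
        simpa using sum_min_pow_card_le (M.side_pos τ).le (fun τ' _ => (M.side_pos τ').le)
          h_disj h_meet
    _ = 9 * M.side τ ^ 2 := by ring

lemma exists_edgeNormal_eq (τ τ' : CellIdx) :
    ∃ d, M.edgeNormal τ τ' = EuclideanSpace.single d 1 := by
  unfold edgeNormal
  split_ifs
  exacts [⟨0, rfl⟩, ⟨1, rfl⟩]

end HierMesh

/-! ### Supports of hierarchical B-splines -/

lemma dense_forall_apply_notMem {ι : Type*} {S : ι → Set ℝ} (hS : ∀ d, (S d).Countable) :
    Dense {x : EuclideanSpace ℝ ι | ∀ d, x d ∉ S d} := by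
  have h_pi : Dense (univ.pi fun d => (S d)ᶜ) := dense_pi univ fun d _ => (hS d).dense_compl ℝ
  exact (h_pi.preimage (PiLp.homeomorph 2 fun _ : ι => ℝ).isOpenMap).mono
    fun _ (hx : _ ∈ univ.pi _) d => hx d (mem_univ d)

namespace KnotSystem

variable {M : HierMesh} {r : ℕ} (K : KnotSystem M r)

lemma not_bddBelow_range_knot (d : Fin 2) (ℓ : ℕ) : ¬ BddBelow (range (K.knot d ℓ)) := by
  rw [K.range_eq]
  exact not_bddBelow_of_tendsto_atBot (M.tendsto_grid_atBot d ℓ)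

lemma not_bddAbove_range_knot (d : Fin 2) (ℓ : ℕ) : ¬ BddAbove (range (K.knot d ℓ)) := by
  rw [K.range_eq]
  exact not_bddAbove_of_tendsto_atTop (M.tendsto_grid_atTop d ℓ)

/-- The interior of the support of a tensor product B-spline, as a function on the plane. -/
def suppBox (q : CellIdx) : Set Plane :=
  openBox (fun d => K.knot d q.1 (q.2 d)) fun d => K.knot d q.1 (q.2 d + r + 1)

lemma isOpen_suppBox (q : CellIdx) : IsOpen (K.suppBox q) := isOpen_openBox _ _

lemma closure_suppBox {q : CellIdx} (h : (K.suppBox q).Nonempty) :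
    closure (K.suppBox q) = closedBox (fun d => K.knot d q.1 (q.2 d)) fun d =>
      K.knot d q.1 (q.2 d + r + 1) := by
  obtain ⟨x, hx⟩ := h
  exact closure_openBox fun d => (hx d).1.trans (hx d).2

lemma closure_suppBox_inter_dom_subset_supp (q : CellIdx) :
    closure (K.suppBox q) ∩ M.dom ⊆ K.supp q := by
  have h_dense : Dense {x : Plane | ∀ d, x d ∉ range (K.knot d q.1)} :=
    dense_forall_apply_notMem fun d => countable_range _
  have h_dom : IsOpen M.dom := isOpen_interior
  refine h_dom.closure_inter.trans (closure_minimal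
    ((h_dense.open_subset_closure_inter ((K.isOpen_suppBox q).inter h_dom)).trans
      (closure_mono ?_)) isClosed_closure)
  rintro x ⟨⟨hx, hx_dom⟩, hx_knot⟩
  exact ⟨(Finset.prod_pos fun d _ => bspline_pos (K.mono d q.1) r (q.2 d) (hx_knot d)
    (hx d).1 (hx d).2).ne', hx_dom⟩

lemma support_tensorBspline_subset (q : CellIdx) : Function.support (K.tensorBspline q) ⊆
    closedBox (fun d => K.knot d q.1 (q.2 d)) fun d => K.knot d q.1 (q.2 d + r + 1) := by
  intro x hx d
  have h_ne := Finset.prod_ne_zero_iff.1 hx d (Finset.mem_univ d)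
  exact ⟨le_of_not_gt fun h => h_ne (bspline_eq_zero (K.mono d q.1) r _ (Or.inl h)),
    le_of_not_gt fun h => h_ne (bspline_eq_zero (K.mono d q.1) r _ (Or.inr h.le))⟩

lemma supp_subset_supp {q q' : CellIdx} (h_nonempty : (K.suppBox q).Nonempty)
    (h : ∀ d, K.knot d q.1 (q.2 d) ≤ K.knot d q'.1 (q'.2 d) ∧
      K.knot d q'.1 (q'.2 d + r + 1) ≤ K.knot d q.1 (q.2 d + r + 1)) :
    K.supp q' ⊆ K.supp q := by
  refine closure_minimal ?_ isClosed_closure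
  rintro x ⟨hx, hx_dom⟩
  refine K.closure_suppBox_inter_dom_subset_supp q ⟨?_, hx_dom⟩
  rw [K.closure_suppBox h_nonempty]
  exact fun d => Icc_subset_Icc (h d).1 (h d).2 (K.support_tensorBspline_subset q' hx d)

lemma exists_mem_suppBox (ℓ : ℕ) {x : Plane} (hx : x ∈ M.dom) :
    ∃ k : Fin 2 → ℤ, x ∈ K.suppBox (ℓ, k) := by
  choose k hk using fun d => exists_knot_lt_lt (K.mono d ℓ) (K.not_bddBelow_range_knot d ℓ)
    (K.not_bddAbove_range_knot d ℓ) (K.mult_lt d ℓ (x d) ⟨x, hx, rfl⟩).le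
  exact ⟨k, hk⟩

/-- A B-spline of level `ℓ + 1` around `x` has its support inside that of one of level `ℓ` around
`x`; the latter lies in `Ω^ℓ` by induction and hence in `Ω^(ℓ+1)`, not being in the basis. -/
lemma supp_subset_subdomain_of_forall_notMem_suppBox {x : Plane}
    (hx : ∀ q, K.IsBasisIdx q → x ∉ K.suppBox q) (ℓ : ℕ) (k : Fin 2 → ℤ)
    (hk : x ∈ K.suppBox (ℓ, k)) : K.supp (ℓ, k) ⊆ M.subdomain ℓ := by
  induction ℓ generalizing k with
  | zero =>
    exact closure_minimal (inter_subset_right.trans interior_subset)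
      (isClosed_biUnion_finset fun k _ => M.isClosed_closedCell _)
  | succ ℓ ih =>
    choose j hj using fun d => exists_knot_interval_superset (K.mono d ℓ)
      (K.not_bddBelow_range_knot d ℓ) (K.not_bddAbove_range_knot d ℓ) (K.mono d (ℓ + 1))
      (K.nested d ℓ) r (k d)
    have hxj : x ∈ K.suppBox (ℓ, j) := fun d => Ioo_subset_Ioo (hj d).1 (hj d).2 (hk d)
    exact (K.supp_subset_supp ⟨x, hxj⟩ hj).trans
      (not_not.1 fun h => hx (ℓ, j) ⟨ih j hxj, h⟩ hxj)

lemma exists_isBasisIdx_mem_suppBox {x : Plane} (hx : x ∈ M.dom) :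
    ∃ q, K.IsBasisIdx q ∧ x ∈ K.suppBox q := by
  by_contra! h_notMem
  obtain ⟨k, hk⟩ := K.exists_mem_suppBox (M.depth + 1) hx
  have h_sub := K.supp_subset_subdomain_of_forall_notMem_suppBox h_notMem _ k hk
  rw [M.subdomain_eq_empty (Nat.lt_succ_self _)] at h_sub
  exact h_sub (K.closure_suppBox_inter_dom_subset_supp _ ⟨subset_closure hk, hx⟩)

lemma supp_inter_cell_nonempty {q τ : CellIdx} (hτ : τ ∈ M.cells) {x : Plane}
    (hx : x ∈ K.suppBox q) (hxτ : x ∈ M.closedCell τ) : (K.supp q ∩ M.cell τ).Nonempty := by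
  rw [← M.closure_cell] at hxτ
  obtain ⟨y, hy, hyτ⟩ := mem_closure_iff.1 hxτ _ (K.isOpen_suppBox q) hx
  exact ⟨y, K.closure_suppBox_inter_dom_subset_supp q
    ⟨subset_closure hy, M.cell_subset_dom hτ hyτ⟩, hyτ⟩

lemma mem_suppExt_of_mem_closedCell {τ τ' : CellIdx} (hτ : τ ∈ M.cells) (hτ' : τ' ∈ M.cells)
    {x : Plane} (hx : x ∈ M.dom) (hxτ : x ∈ M.closedCell τ) (hxτ' : x ∈ M.closedCell τ') :
    τ' ∈ K.suppExt τ := by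
  obtain ⟨q, hq, hxq⟩ := K.exists_isBasisIdx_mem_suppBox hx
  exact ⟨hτ', q, hq, K.supp_inter_cell_nonempty hτ' hxq hxτ',
    K.supp_inter_cell_nonempty hτ hxq hxτ⟩

lemma self_mem_suppExt {τ : CellIdx} (hτ : τ ∈ M.cells) : τ ∈ K.suppExt τ := by
  obtain ⟨x, hx⟩ := M.cell_nonempty τ
  exact K.mem_suppExt_of_mem_closedCell hτ hτ (M.cell_subset_dom hτ hx)
    (M.cell_subset_closedCell τ hx) (M.cell_subset_closedCell τ hx)

lemma neighbors_subset_suppExt {τ : CellIdx} (hτ : τ ∈ M.cells) :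
    (M.neighbors τ : Set CellIdx) ⊆ K.suppExt τ := by
  intro τ' h
  obtain ⟨hτ', h_ne, x, hx⟩ := HierMesh.mem_neighbors.1 h
  exact K.mem_suppExt_of_mem_closedCell hτ hτ' (HierMesh.edge_subset_dom hτ hτ' h_ne.symm hx)
    (M.edge_subset_left _ _ hx) (M.edge_subset_right _ _ hx)

lemma cell_subset_suppExtDom {τ τ' : CellIdx} (h : τ' ∈ K.suppExt τ) :
    M.cell τ' ⊆ K.suppExtDom τ :=
  interior_maximal ((M.cell_subset_closedCell τ').trans
    (subset_biUnion_of_mem (u := fun τ' => M.closedCell τ') h)) (M.isOpen_cell τ')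

end KnotSystem

/-! ### Functions that are polynomials on a cell -/

namespace HierMesh

variable (M : HierMesh)

/-- The functions on the plane which agree on the cell `τ` with a polynomial that belongs to `F`
when written in the coordinates in which `τ` is the unit square. -/
def polyOn (F : Submodule ℝ (MvPolynomial (Fin 2) ℝ)) (τ : CellIdx) : Submodule ℝ (Plane → ℝ) where
  carrier := {U | ∃ P ∈ F, EqOn U (scaledEval (M.lower τ) (M.side τ) P) (M.cell τ)}
  add_mem' := by
    rintro U V ⟨P, hP, hU⟩ ⟨Q, hQ, hV⟩
    exact ⟨P + Q, F.add_mem hP hQ, fun x hx => by simp [hU hx, hV hx]⟩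
  zero_mem' := ⟨0, F.zero_mem, fun x _ => by simp⟩
  smul_mem' := by
    rintro c U ⟨P, hP, hU⟩
    exact ⟨c • P, F.smul_mem c hP, fun x hx => by simp [hU hx]⟩

variable {M} {F : Submodule ℝ (MvPolynomial (Fin 2) ℝ)} {τ : CellIdx} {U V : Plane → ℝ}

lemma exists_contDiff_eqOn_of_mem_polyOn (hU : U ∈ M.polyOn F τ) :
    ∃ p : Plane → ℝ, ContDiff ℝ ∞ p ∧ EqOn U p (M.cell τ) := by
  obtain ⟨P, -, hP⟩ := hU
  exact ⟨_, contDiff_scaledEval _ _ P, hP⟩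

lemma memLp_cell_of_mem_polyOn (hU : U ∈ M.polyOn F τ) :
    MemLp U 2 (volume.restrict (M.cell τ)) := by
  obtain ⟨P, -, hP⟩ := hU
  refine (memLp_congr_ae (ae_restrict_of_forall_mem (M.isOpen_cell τ).measurableSet hP)).2 ?_
  rw [cell_eq_openCube]
  exact memLp_openBox_of_continuous (continuous_scaledEval _ _ P)

lemma trace_eqOn_closedCell {p : Plane → ℝ} (hp : Continuous p) (h : EqOn U p (M.cell τ)) :
    EqOn (M.trace τ U) p (M.closedCell τ) := fun x hx => by
  have : (𝓝[M.cell τ] x).NeBot := mem_closure_iff_nhdsWithin_neBot.1 (M.closure_cell τ ▸ hx)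
  exact ((hp.tendsto x).mono_left nhdsWithin_le_nhds |>.congr'
    (h.symm.eventuallyEq_of_mem self_mem_nhdsWithin)).limUnder_eq

lemma trace_sub_eqOn_closedCell (hU : U ∈ M.polyOn F τ) (hV : V ∈ M.polyOn F τ) :
    EqOn (M.trace τ (U - V)) (M.trace τ U - M.trace τ V) (M.closedCell τ) := fun x hx => by
  obtain ⟨p, hp, hUp⟩ := exists_contDiff_eqOn_of_mem_polyOn hU
  obtain ⟨q, hq, hVq⟩ := exists_contDiff_eqOn_of_mem_polyOn hV
  have h_sub : EqOn (U - V) (p - q) (M.cell τ) := fun y hy => by simp [hUp hy, hVq hy]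
  rw [trace_eqOn_closedCell (hp.continuous.sub hq.continuous) h_sub hx, Pi.sub_apply, Pi.sub_apply,
    trace_eqOn_closedCell hp.continuous hUp hx, trace_eqOn_closedCell hq.continuous hVq hx]

lemma trace_congr (h : EqOn U V (M.cell τ)) : M.trace τ U = M.trace τ V := by
  ext x
  have h_ev : U =ᶠ[𝓝[M.cell τ] x] V := h.eventuallyEq_of_mem self_mem_nhdsWithin
  simp only [trace, limUnder, Filter.map_congr h_ev]

lemma memLp_trace {S : Set Plane} (hU : U ∈ M.polyOn F τ) (hS : S ⊆ M.closedCell τ)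
    (h_meas : MeasurableSet S) {μ : Measure Plane} (hμ : μ S < ⊤) :
    MemLp (M.trace τ U) 2 (μ.restrict S) := by
  obtain ⟨p, hp, hUp⟩ := exists_contDiff_eqOn_of_mem_polyOn hU
  refine (memLp_congr_ae (ae_restrict_of_forall_mem h_meas
    fun x hx => trace_eqOn_closedCell hp.continuous hUp (hS hx))).2 ?_
  exact memLp_restrict_of_continuous (M.isCompact_closedCell τ) hS h_meas hμ hp.continuous

end HierMesh

namespace IsHomogeneousLocalOp

open HierMesh

variable {D : (Plane → ℝ) → Plane → ℝ}
  {L : MvPolynomial (Fin 2) ℝ →ₗ[ℝ] MvPolynomial (Fin 2) ℝ} {n : ℕ}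
  {F : Submodule ℝ (MvPolynomial (Fin 2) ℝ)} {M : HierMesh} {τ : CellIdx} {U V : Plane → ℝ}

lemma mem_polyOn (hD : IsHomogeneousLocalOp D L n) (hU : U ∈ M.polyOn F τ) :
    D U ∈ M.polyOn (F.map L) τ := by
  obtain ⟨P, hP, hU⟩ := hU
  refine ⟨(M.side τ)⁻¹ ^ n • L P, Submodule.smul_mem _ _ (Submodule.mem_map_of_mem hP), ?_⟩
  rw [map_smul]
  exact hD (M.isOpen_cell τ) hU

lemma sub_eqOn_cell (hD : IsHomogeneousLocalOp D L n) (hU : U ∈ M.polyOn F τ)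
    (hV : V ∈ M.polyOn F τ) : EqOn (D (U - V)) (D U - D V) (M.cell τ) := by
  obtain ⟨P, -, hU⟩ := hU
  obtain ⟨Q, -, hV⟩ := hV
  have h_sub : EqOn (U - V) (scaledEval (M.lower τ) (M.side τ) (P - Q)) (M.cell τ) :=
    fun x hx => by simp [hU hx, hV hx]
  intro x hx
  rw [hD (M.isOpen_cell τ) h_sub hx, Pi.sub_apply, hD (M.isOpen_cell τ) hU hx,
    hD (M.isOpen_cell τ) hV hx]
  simp [mul_sub]

lemma trace_sub_eqOn_closedCell (hD : IsHomogeneousLocalOp D L n) (hU : U ∈ M.polyOn F τ)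
    (hV : V ∈ M.polyOn F τ) :
    EqOn (M.trace τ (D (U - V))) (M.trace τ (D U) - M.trace τ (D V)) (M.closedCell τ) := by
  rw [trace_congr (hD.sub_eqOn_cell hU hV)]
  exact HierMesh.trace_sub_eqOn_closedCell (hD.mem_polyOn hU) (hD.mem_polyOn hV)

end IsHomogeneousLocalOp

namespace KnotSystem

variable {M : HierMesh} {r : ℕ} (K : KnotSystem M r)

lemma exists_polynomial_eqOn_bspline_knot (d : Fin 2) {m : ℕ} {τ : CellIdx} (h : m ≤ τ.1) (i : ℤ) :
    ∃ P : Polynomial ℝ, P.natDegree ≤ r ∧ ∀ x ∈ M.cell τ,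
      bspline (K.knot d m) r i (x d) = P.eval ((x d - M.lower τ d) / M.side τ) := by
  have h_knot : ∀ j, K.knot d m j ≤ M.grid d τ.1 (τ.2 d) ∨
      M.grid d τ.1 (τ.2 d + 1) ≤ K.knot d m j := fun j => by
    obtain ⟨k, hk⟩ : K.knot d m j ∈ range (M.grid d m) := K.range_eq d m ▸ mem_range_self j
    exact hk ▸ M.grid_le_or_le d h k (τ.2 d)
  obtain ⟨P, h_deg, hP⟩ := exists_polynomial_eqOn_bspline h_knot r i
  refine ⟨P.comp (Polynomial.C (M.side τ) * Polynomial.X + Polynomial.C (M.lower τ d)), ?_,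
    fun x hx => (hP (hx d)).trans ?_⟩
  · calc _ ≤ P.natDegree * 1 := Polynomial.natDegree_comp_le.trans
          (Nat.mul_le_mul_left _ Polynomial.natDegree_linear_le)
      _ ≤ r := (mul_one _).trans_le h_deg
  · simp [mul_div_cancel₀ _ (M.side_pos τ).ne']

lemma tensorBspline_mem_polyOn {q τ : CellIdx} (hq : K.IsBasisIdx q) (hτ : τ ∈ M.cells) :
    K.tensorBspline q ∈ M.polyOn (MvPolynomial.restrictDegree (Fin 2) ℝ r) τ := by
  rcases le_or_gt q.1 τ.1 with h | h
  · choose P h_deg hP using fun d => K.exists_polynomial_eqOn_bspline_knot d h (q.2 d)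
    refine ⟨_, prod_aeval_X_mem_restrictDegree h_deg, fun x hx => ?_⟩
    simp only [tensorBspline, hP _ x hx, map_prod, Finset.prod_apply, scaledEval_aeval_X]
  · refine ⟨0, Submodule.zero_mem _, fun x hx => ?_⟩
    rw [map_zero, Pi.zero_apply]
    by_contra h_ne
    exact disjoint_left.1 (M.disjoint_cell_subdomain hτ h) hx
      (hq.1 (subset_closure ⟨h_ne, M.cell_subset_dom hτ hx⟩))

lemma splineSpace_le_polyOn {τ : CellIdx} (hτ : τ ∈ M.cells) :
    K.splineSpace ≤ M.polyOn (MvPolynomial.restrictDegree (Fin 2) ℝ r) τ := by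
  refine Submodule.span_le.2 ?_
  rintro _ ⟨q, hq, rfl⟩
  exact K.tensorBspline_mem_polyOn hq hτ

end KnotSystem

/-! ### Inverse estimates on cells and edges -/

namespace IsHomogeneousLocalOp

open HierMesh

variable {D : (Plane → ℝ) → Plane → ℝ}
  {L : MvPolynomial (Fin 2) ℝ →ₗ[ℝ] MvPolynomial (Fin 2) ℝ} {n : ℕ}
  (hD : IsHomogeneousLocalOp D L n) (F : Submodule ℝ (MvPolynomial (Fin 2) ℝ))
  [FiniteDimensional ℝ F]
include hD

lemma exists_integral_sq_le : ∃ C : ℝ, 0 ≤ C ∧ ∀ (M : HierMesh) (τ : CellIdx), ∀ U ∈ M.polyOn F τ,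
    M.side τ ^ (2 * n) * ∫ x in M.cell τ, D U x ^ 2 ≤ C * ∫ x in M.cell τ, U x ^ 2 := by
  obtain ⟨C, hC, h⟩ := exists_integral_sq_scaledEval_le F L
  refine ⟨C, hC, fun M τ U ⟨P, hP, hU⟩ => ?_⟩
  have h_meas := (M.isOpen_cell τ).measurableSet
  have h_side := (M.side_pos τ).ne'
  have hDU : EqOn (fun x => M.side τ ^ (2 * n) * D U x ^ 2)
      (fun x => scaledEval (M.lower τ) (M.side τ) (L P) x ^ 2) (M.cell τ) := fun x hx => by
    simp only [hD (M.isOpen_cell τ) hU hx, Pi.smul_apply, smul_eq_mul, inv_pow]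
    field_simp
    ring
  rw [← integral_const_mul, setIntegral_congr_fun h_meas hDU,
    setIntegral_congr_fun h_meas fun x hx => congrArg (· ^ 2) (hU hx), cell_eq_openCube]
  exact h P hP _ _ (M.side_pos τ)

lemma exists_sq_trace_le : ∃ C : ℝ, 0 ≤ C ∧ ∀ (M : HierMesh) (τ : CellIdx), ∀ U ∈ M.polyOn F τ,
    ∀ x ∈ M.closedCell τ,
      M.side τ ^ (2 * n + 2) * M.trace τ (D U) x ^ 2 ≤ C * ∫ y in M.cell τ, U y ^ 2 := by
  obtain ⟨C, hC, h⟩ := exists_sq_scaledEval_le F L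
  refine ⟨C, hC, fun M τ U ⟨P, hP, hU⟩ x hx => ?_⟩
  have h_trace := trace_eqOn_closedCell ((continuous_scaledEval _ _ (L P)).const_smul _)
    (hD (M.isOpen_cell τ) hU) hx
  have h_side := (M.side_pos τ).ne'
  rw [closedCell_eq_closedCube] at hx
  have h_le := h P hP _ _ (M.side_pos τ) x hx
  rw [h_trace, setIntegral_congr_fun (M.isOpen_cell τ).measurableSet
    fun x hx => congrArg (· ^ 2) (hU hx), cell_eq_openCube]
  convert h_le using 1
  simp only [Pi.smul_apply, smul_eq_mul, Fintype.card_fin, inv_pow]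
  field_simp
  ring

lemma exists_sq_jump_le : ∃ C : ℝ, 0 ≤ C ∧ ∀ (M : HierMesh) (τ τ' : CellIdx),
    ∀ U ∈ M.polyOn F τ ⊓ M.polyOn F τ', ∀ x ∈ M.closedCell τ ∩ M.closedCell τ',
      min (M.side τ) (M.side τ') ^ (2 * n + 2) * M.jump τ τ' (D U) x ^ 2
        ≤ C * ((min (M.side τ) (M.side τ') / M.side τ) ^ 2 * (∫ x in M.cell τ, U x ^ 2)
          + ∫ x in M.cell τ', U x ^ 2) := by
  obtain ⟨C, hC, h⟩ := hD.exists_sq_trace_le F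
  refine ⟨2 * C, by positivity, fun M τ τ' U ⟨hU, hU'⟩ x ⟨hx, hx'⟩ => ?_⟩
  have h_trace := h M τ U hU x hx
  have h_trace' := h M τ' U hU' x hx'
  have hs := M.side_pos τ
  have hs' := M.side_pos τ'
  set s := M.side τ
  set s' := M.side τ'
  set m := min s s'
  have hm : 0 < m := lt_min hs hs'
  have h_scale : m ^ (2 * n + 2) ≤ (m / s) ^ 2 * s ^ (2 * n + 2) := by
    calc m ^ (2 * n + 2) = m ^ 2 * m ^ (2 * n) := by ring
      _ ≤ m ^ 2 * s ^ (2 * n) := by gcongr; exact min_le_left s s'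
      _ = (m / s) ^ 2 * s ^ (2 * n + 2) := by field_simp; ring
  have h_scale' : m ^ (2 * n + 2) ≤ s' ^ (2 * n + 2) := by gcongr; exact min_le_right s s'
  calc m ^ (2 * n + 2) * M.jump τ τ' (D U) x ^ 2
      ≤ m ^ (2 * n + 2) * (2 * (M.trace τ (D U) x ^ 2 + M.trace τ' (D U) x ^ 2)) := by
        gcongr
        simpa [jump, sub_eq_add_neg] using
          add_sq_le (a := M.trace τ (D U) x) (b := -M.trace τ' (D U) x)
    _ = 2 * (m ^ (2 * n + 2) * M.trace τ (D U) x ^ 2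
          + m ^ (2 * n + 2) * M.trace τ' (D U) x ^ 2) := by ring
    _ ≤ 2 * ((m / s) ^ 2 * s ^ (2 * n + 2) * M.trace τ (D U) x ^ 2
          + s' ^ (2 * n + 2) * M.trace τ' (D U) x ^ 2) := by gcongr
    _ ≤ 2 * ((m / s) ^ 2 * (C * ∫ y in M.cell τ, U y ^ 2) + C * ∫ y in M.cell τ', U y ^ 2) := by
        rw [mul_assoc ((m / s) ^ 2)]
        gcongr
    _ = _ := by ring

lemma exists_integral_sq_jump_le : ∃ C : ℝ, 0 ≤ C ∧ ∀ (M : HierMesh), ∀ τ ∈ M.cells, ∀ τ' ∈ M.cells,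
    τ ≠ τ' → ∀ U ∈ M.polyOn F τ ⊓ M.polyOn F τ',
      Metric.diam (M.edge τ τ') ^ (2 * n + 1)
          * ∫ x in M.edge τ τ', M.jump τ τ' (D U) x ^ 2 ∂(Measure.hausdorffMeasure 1)
        ≤ C * ((min (M.side τ) (M.side τ') / M.side τ) ^ 2 * (∫ x in M.cell τ, U x ^ 2)
          + ∫ x in M.cell τ', U x ^ 2) := by
  obtain ⟨C, hC, h⟩ := hD.exists_sq_jump_le F
  refine ⟨C, hC, fun M τ hτ τ' hτ' h_ne U hU => ?_⟩
  obtain ⟨h_diam, h_measure⟩ := diam_and_hausdorffMeasure_edge_le hτ hτ' h_ne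
  have hm : 0 < min (M.side τ) (M.side τ') := lt_min (M.side_pos τ) (M.side_pos τ')
  set m := min (M.side τ) (M.side τ')
  set B := C * ((m / M.side τ) ^ 2 * (∫ x in M.cell τ, U x ^ 2) + ∫ x in M.cell τ', U x ^ 2)
  have h_jump : ∀ x ∈ M.edge τ τ', ‖M.jump τ τ' (D U) x ^ 2‖ ≤ B / m ^ (2 * n + 2) :=
    fun x hx => by
      rw [Real.norm_of_nonneg (sq_nonneg _), le_div_iff₀' (by positivity)]
      exact h M τ τ' U hU x hx.1
  have : 0 ≤ B := by positivity
  calc Metric.diam (M.edge τ τ') ^ (2 * n + 1)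
        * ∫ x in M.edge τ τ', M.jump τ τ' (D U) x ^ 2 ∂(Measure.hausdorffMeasure 1)
      ≤ m ^ (2 * n + 1) * (B / m ^ (2 * n + 2)
          * (Measure.hausdorffMeasure 1).real (M.edge τ τ')) := by
        gcongr
        exact (le_abs_self _).trans (norm_setIntegral_le_of_norm_le_const
          (h_measure.trans_lt ENNReal.ofReal_lt_top) h_jump)
    _ ≤ m ^ (2 * n + 1) * (B / m ^ (2 * n + 2) * m) := by
        gcongr
        exact ENNReal.toReal_le_of_le_ofReal hm.le h_measure
    _ = B := by field_simp; ring

end IsHomogeneousLocalOp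

/-! ### The error indicator of a difference -/

lemma sq_sqrt_sum_sub_sqrt_sum_le {ι : Type*} (s : Finset ι) {X Y : ι → ℝ}
    (hX : ∀ i, 0 ≤ X i) (hY : ∀ i, 0 ≤ Y i) :
    (√(∑ i ∈ s, X i) - √(∑ i ∈ s, Y i)) ^ 2 ≤ ∑ i ∈ s, (√(X i) - √(Y i)) ^ 2 := by
  have h_cauchy := Real.sum_sqrt_mul_sqrt_le s hX hY
  calc (√(∑ i ∈ s, X i) - √(∑ i ∈ s, Y i)) ^ 2
      = ∑ i ∈ s, X i + ∑ i ∈ s, Y i - 2 * (√(∑ i ∈ s, X i) * √(∑ i ∈ s, Y i)) := by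
        rw [sub_sq, Real.sq_sqrt (Finset.sum_nonneg fun i _ => hX i),
          Real.sq_sqrt (Finset.sum_nonneg fun i _ => hY i)]
        ring
    _ ≤ ∑ i ∈ s, X i + ∑ i ∈ s, Y i - 2 * ∑ i ∈ s, √(X i) * √(Y i) := by gcongr
    _ = ∑ i ∈ s, (√(X i) - √(Y i)) ^ 2 := by
        rw [Finset.mul_sum, ← Finset.sum_add_distrib, ← Finset.sum_sub_distrib]
        refine Finset.sum_congr rfl fun i _ => ?_
        rw [sub_sq, Real.sq_sqrt (hX i), Real.sq_sqrt (hY i)]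
        ring

lemma sq_sqrt_add_sub_sqrt_add_le {X X' Y Y' : ℝ} (hX : 0 ≤ X) (hX' : 0 ≤ X') (hY : 0 ≤ Y)
    (hY' : 0 ≤ Y') : (√(X + X') - √(Y + Y')) ^ 2 ≤ (√X - √Y) ^ 2 + (√X' - √Y') ^ 2 := by
  simpa using sq_sqrt_sum_sub_sqrt_sum_le Finset.univ (X := ![X, X']) (Y := ![Y, Y'])
    (Fin.forall_fin_two.2 ⟨hX, hX'⟩) (Fin.forall_fin_two.2 ⟨hY, hY'⟩)

lemma sq_sqrt_mul_integral_sq_sub_le {α : Type*} [MeasurableSpace α] {μ : Measure α} {f g : α → ℝ}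
    (hf : MemLp f 2 μ) (hg : MemLp g 2 μ) {w : ℝ} (hw : 0 ≤ w) :
    (√(w * ∫ x, f x ^ 2 ∂μ) - √(w * ∫ x, g x ^ 2 ∂μ)) ^ 2 ≤ w * ∫ x, (f - g) x ^ 2 ∂μ := by
  rw [← norm_toLp_two_sq (hf.sub hg), MemLp.toLp_sub hf hg, ← norm_toLp_two_sq hf,
    ← norm_toLp_two_sq hg, Real.sqrt_mul hw, Real.sqrt_mul hw, Real.sqrt_sq (norm_nonneg _),
    Real.sqrt_sq (norm_nonneg _), ← mul_sub, mul_pow, Real.sq_sqrt hw]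
  gcongr ?_ * ?_
  exact sq_le_sq.2 ((abs_norm_sub_norm_le _ _).trans_eq (abs_norm _).symm)

lemma IsHomogeneousLocalOp.sq_sqrt_mul_integral_jump_sub_le {D : (Plane → ℝ) → Plane → ℝ}
    {L : MvPolynomial (Fin 2) ℝ →ₗ[ℝ] MvPolynomial (Fin 2) ℝ} {n : ℕ}
    (hD : IsHomogeneousLocalOp D L n) {F : Submodule ℝ (MvPolynomial (Fin 2) ℝ)} {M : HierMesh}
    {τ τ' : CellIdx} (hτ : τ ∈ M.cells) (hτ' : τ' ∈ M.cells) (h_ne : τ ≠ τ') {V W : Plane → ℝ}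
    (hV : V ∈ M.polyOn F τ ⊓ M.polyOn F τ') (hW : W ∈ M.polyOn F τ ⊓ M.polyOn F τ')
    {w : ℝ} (hw : 0 ≤ w) :
    (√(w * ∫ x in M.edge τ τ', M.jump τ τ' (D V) x ^ 2 ∂(Measure.hausdorffMeasure 1))
        - √(w * ∫ x in M.edge τ τ', M.jump τ τ' (D W) x ^ 2 ∂(Measure.hausdorffMeasure 1))) ^ 2
      ≤ w * ∫ x in M.edge τ τ', M.jump τ τ' (D (V - W)) x ^ 2
          ∂(Measure.hausdorffMeasure 1) := by
  have h_meas := M.measurableSet_edge τ τ'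
  have h_left := M.edge_subset_left τ τ'
  have h_right := M.edge_subset_right τ τ'
  have h_finite := (HierMesh.diam_and_hausdorffMeasure_edge_le hτ hτ' h_ne).2.trans_lt
    ENNReal.ofReal_lt_top
  have h_memLp : ∀ {U}, U ∈ M.polyOn F τ ⊓ M.polyOn F τ' →
      MemLp (M.jump τ τ' (D U)) 2 ((Measure.hausdorffMeasure 1).restrict (M.edge τ τ')) :=
    fun ⟨hU, hU'⟩ =>
      (HierMesh.memLp_trace (hD.mem_polyOn hU) h_left h_meas h_finite).sub
        (HierMesh.memLp_trace (hD.mem_polyOn hU') h_right h_meas h_finite)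
  refine (sq_sqrt_mul_integral_sq_sub_le (h_memLp hV) (h_memLp hW) hw).trans_eq
    (congrArg (w * ·) (setIntegral_congr_fun h_meas fun x hx => ?_))
  simp only [HierMesh.jump, hD.trace_sub_eqOn_closedCell hV.1 hW.1 (h_left hx),
    hD.trace_sub_eqOn_closedCell hV.2 hW.2 (h_right hx), Pi.sub_apply]
  ring

lemma exists_integral_sq_jump_edgeNormal_le (F : Submodule ℝ (MvPolynomial (Fin 2) ℝ))
    [FiniteDimensional ℝ F] : ∃ C : ℝ, 0 ≤ C ∧ ∀ (M : HierMesh), ∀ τ ∈ M.cells, ∀ τ' ∈ M.cells,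
      τ ≠ τ' → ∀ U ∈ M.polyOn F τ ⊓ M.polyOn F τ',
        Metric.diam (M.edge τ τ') ^ 3
            * ∫ x in M.edge τ τ', M.jump τ τ' (fun y => fderiv ℝ U y (M.edgeNormal τ τ')) x ^ 2
                ∂(Measure.hausdorffMeasure 1)
          ≤ C * ((min (M.side τ) (M.side τ') / M.side τ) ^ 2 * (∫ x in M.cell τ, U x ^ 2)
            + ∫ x in M.cell τ', U x ^ 2) := by
  choose C hC h using fun d =>
    (isHomogeneousLocalOp_fderiv_single d).exists_integral_sq_jump_le F
  refine ⟨∑ d, C d, Finset.sum_nonneg fun d _ => hC d, fun M τ hτ τ' hτ' h_ne U hU => ?_⟩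
  obtain ⟨d, hd⟩ := HierMesh.exists_edgeNormal_eq (M := M) τ τ'
  rw [hd]
  refine (h d M τ hτ τ' hτ' h_ne U hU).trans (mul_le_mul_of_nonneg_right ?_ (by positivity))
  exact Finset.single_le_sum (fun d _ => hC d) (Finset.mem_univ d)

namespace HierMesh

variable {M : HierMesh}

lemma sq_eta_sub_eta_le {F : Submodule ℝ (MvPolynomial (Fin 2) ℝ)} {τ : CellIdx}
    (hτ : τ ∈ M.cells) {f V W : Plane → ℝ} (hf : MemLp f 2 (volume.restrict (M.cell τ)))
    (hV : ∀ τ' ∈ M.cells, V ∈ M.polyOn F τ') (hW : ∀ τ' ∈ M.cells, W ∈ M.polyOn F τ') :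
    (M.eta f V τ - M.eta f W τ) ^ 2 ≤ M.etaSq 0 (V - W) τ := by
  have hΔ := isHomogeneousLocalOp_laplacian (ι := Fin 2)
  have hΔ2 := hΔ.comp hΔ
  have h_diam : ∀ τ', 0 ≤ Metric.diam (M.edge τ τ') := fun _ => Metric.diam_nonneg
  have h_size : 0 ≤ M.cellSize τ := Metric.diam_nonneg
  have h_residual := sq_sqrt_mul_integral_sq_sub_le
    (hf.sub (memLp_cell_of_mem_polyOn (hΔ2.mem_polyOn (hV τ hτ))))
    (hf.sub (memLp_cell_of_mem_polyOn (hΔ2.mem_polyOn (hW τ hτ)))) (pow_nonneg h_size 4)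
  refine (sq_sqrt_add_sub_sqrt_add_le (by positivity) (Finset.sum_nonneg fun τ' _ => by positivity)
    (by positivity) (Finset.sum_nonneg fun τ' _ => by positivity)).trans
      (add_le_add (h_residual.trans_eq (congrArg _ ?_)) ?_)
  · refine setIntegral_congr_fun (M.isOpen_cell τ).measurableSet fun x hx => ?_
    simp only [hΔ2.sub_eqOn_cell (hV τ hτ) (hW τ hτ) hx, Pi.sub_apply, Pi.zero_apply]
    ring
  · refine (sq_sqrt_sum_sub_sqrt_sum_le _ (fun τ' => by positivity)
      fun τ' => by positivity).trans (Finset.sum_le_sum fun τ' h => ?_)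
    obtain ⟨hτ', h_ne, -⟩ := mem_neighbors.1 h
    obtain ⟨d, hd⟩ := exists_edgeNormal_eq (M := M) τ τ'
    rw [hd]
    have h_normal := (isHomogeneousLocalOp_fderiv_single d).comp hΔ
    exact (sq_sqrt_add_sub_sqrt_add_le (by positivity) (by positivity) (by positivity)
      (by positivity)).trans (add_le_add
        (h_normal.sq_sqrt_mul_integral_jump_sub_le hτ hτ' h_ne.symm ⟨hV τ hτ, hV τ' hτ'⟩
          ⟨hW τ hτ, hW τ' hτ'⟩ (by positivity))
        (hΔ.sq_sqrt_mul_integral_jump_sub_le hτ hτ' h_ne.symm ⟨hV τ hτ, hV τ' hτ'⟩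
          ⟨hW τ hτ, hW τ' hτ'⟩ (h_diam τ')))

open Classical in
/-- A cell together with the cells that share an edge with it. -/
def edgePatch (M : HierMesh) (τ : CellIdx) : Finset CellIdx := insert τ (M.neighbors τ)

lemma notMem_neighbors_self (τ : CellIdx) : τ ∉ M.neighbors τ := fun h =>
  (mem_neighbors.1 h).2.1 rfl

lemma edgePatch_subset_cells {τ : CellIdx} (hτ : τ ∈ M.cells) : M.edgePatch τ ⊆ M.cells :=
  Finset.insert_subset hτ fun _ h => (mem_neighbors.1 h).1

lemma sum_neighbors_le_sum_edgePatch (τ : CellIdx) {I : CellIdx → ℝ} (hI : ∀ τ', 0 ≤ I τ') :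
    ∑ τ' ∈ M.neighbors τ, ((min (M.side τ) (M.side τ') / M.side τ) ^ 2 * I τ + I τ')
      ≤ 9 * ∑ τ' ∈ M.edgePatch τ, I τ' := by
  have h_side := M.side_pos τ
  have h_count : ∑ τ' ∈ M.neighbors τ, (min (M.side τ) (M.side τ') / M.side τ) ^ 2 ≤ 9 := by
    simp only [div_pow]
    rw [← Finset.sum_div, div_le_iff₀ (by positivity)]
    exact sum_neighbors_min_side_sq_le τ
  have h_nonneg : 0 ≤ ∑ τ' ∈ M.neighbors τ, I τ' := Finset.sum_nonneg fun τ' _ => hI τ'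
  rw [edgePatch, Finset.sum_insert (notMem_neighbors_self τ), Finset.sum_add_distrib,
    ← Finset.sum_mul]
  nlinarith [mul_le_mul_of_nonneg_right h_count (hI τ)]

lemma cellSize_pow_four_le (τ : CellIdx) : M.cellSize τ ^ 4 ≤ 4 * M.side τ ^ 4 :=
  calc M.cellSize τ ^ 4 ≤ (√2 * M.side τ) ^ 4 :=
        pow_le_pow_left₀ Metric.diam_nonneg (M.cellSize_le τ) 4
    _ = 4 * M.side τ ^ 4 := by
        rw [mul_pow, show √2 ^ 4 = (√2 ^ 2) ^ 2 by ring, Real.sq_sqrt zero_le_two]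
        norm_num

lemma exists_cellSize_pow_four_mul_integral_bilaplacian_sq_le
    (F : Submodule ℝ (MvPolynomial (Fin 2) ℝ)) [FiniteDimensional ℝ F] :
    ∃ C : ℝ, 0 ≤ C ∧ ∀ (M : HierMesh) (τ : CellIdx), ∀ U ∈ M.polyOn F τ,
      M.cellSize τ ^ 4 * ∫ x in M.cell τ, Laplacian.laplacian (Laplacian.laplacian U) x ^ 2
        ≤ C * ∫ x in M.cell τ, Laplacian.laplacian U x ^ 2 := by
  have hΔ := isHomogeneousLocalOp_laplacian (ι := Fin 2)
  obtain ⟨C, hC, h_residual⟩ := hΔ.exists_integral_sq_le (F.map polyLaplacian)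
  refine ⟨4 * C, by positivity, fun M τ U hU => ?_⟩
  refine (mul_le_mul_of_nonneg_right (cellSize_pow_four_le τ) (by positivity)).trans ?_
  rw [mul_assoc, mul_assoc]
  exact mul_le_mul_of_nonneg_left (h_residual M τ _ (hΔ.mem_polyOn hU)) zero_le_four

lemma exists_etaSq_zero_le (F : Submodule ℝ (MvPolynomial (Fin 2) ℝ)) [FiniteDimensional ℝ F] :
    ∃ C : ℝ, 0 ≤ C ∧ ∀ (M : HierMesh), ∀ τ ∈ M.cells, ∀ U : Plane → ℝ,
      (∀ τ' ∈ M.cells, U ∈ M.polyOn F τ') →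
        M.etaSq 0 U τ
          ≤ C * ∑ τ' ∈ M.edgePatch τ, ∫ x in M.cell τ', Laplacian.laplacian U x ^ 2 := by
  have hΔ := isHomogeneousLocalOp_laplacian (ι := Fin 2)
  obtain ⟨C₀, hC₀, h_residual⟩ := exists_cellSize_pow_four_mul_integral_bilaplacian_sq_le F
  obtain ⟨C₁, hC₁, h_normal⟩ := exists_integral_sq_jump_edgeNormal_le (F.map polyLaplacian)
  obtain ⟨C₂, hC₂, h_value⟩ :=
    isHomogeneousLocalOp_id.exists_integral_sq_jump_le (F.map polyLaplacian)
  refine ⟨C₀ + (C₁ + C₂) * 9, by positivity, fun M τ hτ U hU => ?_⟩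
  have hΔU : ∀ τ' ∈ M.cells, Laplacian.laplacian U ∈ M.polyOn (F.map polyLaplacian) τ' :=
    fun τ' hτ' => hΔ.mem_polyOn (hU τ' hτ')
  set I := fun τ' => ∫ x in M.cell τ', Laplacian.laplacian U x ^ 2
  have hI : ∀ τ', 0 ≤ I τ' := fun τ' => by positivity
  rw [add_mul, etaSq]
  refine add_le_add ?_ ?_
  · simp only [Pi.zero_apply, zero_sub, neg_sq]
    exact (h_residual M τ U (hU τ hτ)).trans (mul_le_mul_of_nonneg_left
      (Finset.single_le_sum (fun τ' _ => hI τ') (Finset.mem_insert_self _ _)) hC₀)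
  · rw [mul_assoc]
    refine le_trans ?_ (mul_le_mul_of_nonneg_left (sum_neighbors_le_sum_edgePatch τ hI)
      (add_nonneg hC₁ hC₂))
    rw [Finset.mul_sum]
    refine Finset.sum_le_sum fun τ' h => ?_
    obtain ⟨hτ', h_ne, -⟩ := mem_neighbors.1 h
    have hU_edge := Submodule.mem_inf.2 ⟨hΔU τ hτ, hΔU τ' hτ'⟩
    rw [add_mul]
    refine add_le_add (h_normal M τ hτ τ' hτ' h_ne.symm _ hU_edge) ?_
    simpa using h_value M τ hτ τ' hτ' h_ne.symm _ hU_edge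

end HierMesh

/-! ### Weak derivatives of piecewise smooth functions -/

lemma contDiff_fderiv_apply {E : Type*} [NormedAddCommGroup E] [NormedSpace ℝ E] {f : E → ℝ}
    {m n : WithTop ℕ∞} (hf : ContDiff ℝ n f) (h : m + 1 ≤ n) (v : E) :
    ContDiff ℝ m fun x => fderiv ℝ f x v :=
  (hf.fderiv_right h).clm_apply contDiff_const

lemma integral_mul_fderiv_fderiv {E : Type*} [NormedAddCommGroup E] [NormedSpace ℝ E]
    [FiniteDimensional ℝ E] [MeasurableSpace E] [BorelSpace E] {μ : Measure E}
    [μ.IsAddHaarMeasure] {p φ : E → ℝ} (hp : ContDiff ℝ 2 p) (hφ : ContDiff ℝ 2 φ)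
    (h_compact : HasCompactSupport φ) (v w : E) :
    ∫ x, p x * fderiv ℝ (fun y => fderiv ℝ φ y v) x w ∂μ
      = ∫ x, fderiv ℝ (fun y => fderiv ℝ p y w) x v * φ x ∂μ := by
  have hp' := contDiff_fderiv_apply (m := 1) hp (by norm_num) w
  have hφ' := contDiff_fderiv_apply (m := 1) hφ (by norm_num) v
  have hp'' := (contDiff_fderiv_apply (m := 0) hp' (by norm_num) v).continuous
  have hφ'' := (contDiff_fderiv_apply (m := 0) hφ' (by norm_num) w).continuous
  have h_compact' := h_compact.fderiv_apply ℝ v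
  have h_int : ∀ {f g : E → ℝ}, Continuous f → Continuous g → HasCompactSupport g →
      Integrable (fun x => f x * g x) μ := fun hf hg h =>
    (hf.mul hg).integrable_of_hasCompactSupport h.mul_left
  have h_mid := h_int hp'.continuous hφ'.continuous h_compact'
  rw [integral_mul_fderiv_eq_neg_fderiv_mul_of_integrable h_mid
      (h_int hp.continuous hφ'' (h_compact'.fderiv_apply ℝ w))
      (h_int hp.continuous hφ'.continuous h_compact')
      (fun x _ => (hp.differentiable (by norm_num)).differentiableAt)
      fun x _ => (hφ'.differentiable (by norm_num)).differentiableAt,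
    integral_mul_fderiv_eq_neg_fderiv_mul_of_integrable (h_int hp'' hφ.continuous h_compact) h_mid
      (h_int hp'.continuous hφ.continuous h_compact)
      (fun x _ => (hp'.differentiable (by norm_num)).differentiableAt)
      fun x _ => (hφ.differentiable (by norm_num)).differentiableAt, neg_neg]

lemma integrable_mul_of_locallyIntegrableOn {E : Type*} [NormedAddCommGroup E] [MeasurableSpace E]
    [BorelSpace E] {μ : Measure E} {O : Set E} {f φ : E → ℝ} (hf : LocallyIntegrableOn f O μ)
    (hφ : Continuous φ) (h_compact : HasCompactSupport φ) (h_supp : tsupport φ ⊆ O) :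
    Integrable (fun x => f x * φ x) μ := by
  have h_on : IntegrableOn (fun x => f x * φ x) (tsupport φ) μ :=
    (hf.integrableOn_compact_subset h_supp h_compact).mul_continuousOn hφ.continuousOn h_compact
  exact (integrableOn_iff_integrable_of_support_subset fun x hx =>
    subset_tsupport φ (right_ne_zero_of_mul hx)).1 h_on

namespace IsWeakSecondDeriv

variable {U O : Set Plane} {i j : Fin 2} {v g p : Plane → ℝ}

lemma integral_mul_eq (h : IsWeakSecondDeriv U i j v g) (hOU : O ⊆ U) (hp : ContDiff ℝ 2 p)
    (hvp : EqOn v p O) {φ : Plane → ℝ} (hφ : ContDiff ℝ ∞ φ) (h_compact : HasCompactSupport φ)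
    (h_supp : tsupport φ ⊆ O) : ∫ x, g x * φ x
      = ∫ x, fderiv ℝ (fun y => fderiv ℝ p y (unitVec i)) x (unitVec j) * φ x := by
  set φ'' := fun x => fderiv ℝ (fun y => fderiv ℝ φ y (unitVec j)) x (unitVec i)
  have hφ''_zero : ∀ x ∉ O, φ'' x = 0 := fun x hx => image_eq_zero_of_notMem_tsupport
    fun h => hx (h_supp (tsupport_fderiv_apply_subset ℝ (unitVec j)
      (tsupport_fderiv_apply_subset ℝ (unitVec i) h)))
  have hφ_zero : ∀ x ∉ O, φ x = 0 := fun x hx =>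
    image_eq_zero_of_notMem_tsupport fun h => hx (h_supp h)
  calc ∫ x, g x * φ x = ∫ x in U, g x * φ x :=
        (setIntegral_eq_integral_of_forall_compl_eq_zero fun x hx => by
          rw [hφ_zero x fun h => hx (hOU h), mul_zero]).symm
    _ = ∫ x in U, v x * φ'' x := (h.2.2 φ hφ h_compact (h_supp.trans hOU)).symm
    _ = ∫ x, v x * φ'' x := setIntegral_eq_integral_of_forall_compl_eq_zero fun x hx => by
        rw [hφ''_zero x fun h => hx (hOU h), mul_zero]
    _ = ∫ x, p x * φ'' x := integral_congr_ae (Eventually.of_forall fun x => by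
        by_cases hx : x ∈ O
        · simp only [hvp hx]
        · simp only [hφ''_zero x hx, mul_zero])
    _ = _ := integral_mul_fderiv_fderiv hp (hφ.of_le (by norm_cast)) h_compact _ _

lemma ae_eq (h : IsWeakSecondDeriv U i j v g) (hO : IsOpen O) (hOU : O ⊆ U) (hp : ContDiff ℝ 2 p)
    (hvp : EqOn v p O) : g =ᵐ[volume.restrict O]
      fun x => fderiv ℝ (fun y => fderiv ℝ p y (unitVec i)) x (unitVec j) := by
  have hp'' : Continuous fun x => fderiv ℝ (fun y => fderiv ℝ p y (unitVec i)) x (unitVec j) :=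
    (contDiff_fderiv_apply (m := 0) (contDiff_fderiv_apply (m := 1) hp (by norm_num) _)
      (by norm_num) _).continuous
  set p'' := fun x => fderiv ℝ (fun y => fderiv ℝ p y (unitVec i)) x (unitVec j)
  suffices ∀ᵐ x, x ∈ O → (g - p'') x = 0 from
    (ae_restrict_iff' hO.measurableSet).2 (this.mono fun x hx hxO => sub_eq_zero.1 (hx hxO))
  have hg_loc := h.2.1.mono_set hOU
  have hp''_loc := hp''.locallyIntegrable.locallyIntegrableOn (μ := volume) O
  refine hO.ae_eq_zero_of_integral_contDiff_smul_eq_zero (hg_loc.sub hp''_loc)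
    fun φ hφ h_compact h_supp => ?_
  simp only [smul_eq_mul, Pi.sub_apply, mul_comm (φ _), sub_mul]
  rw [integral_sub
      (integrable_mul_of_locallyIntegrableOn hg_loc hφ.continuous h_compact h_supp)
      (integrable_mul_of_locallyIntegrableOn hp''_loc hφ.continuous h_compact h_supp), sub_eq_zero]
  exact h.integral_mul_eq hOU hp hvp hφ h_compact h_supp

end IsWeakSecondDeriv

lemma laplacian_ae_eq_sum_of_isWeakSecondDeriv {U O : Set Plane} {v p : Plane → ℝ}
    {g : Fin 2 → Plane → ℝ} (hg : ∀ i, IsWeakSecondDeriv U i i v (g i)) (hO : IsOpen O)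
    (hOU : O ⊆ U) (hp : ContDiff ℝ 2 p) (hvp : EqOn v p O) :
    Laplacian.laplacian v =ᵐ[volume.restrict O] ∑ i, g i := by
  filter_upwards [ae_all_iff.2 fun i => (hg i).ae_eq hO hOU hp hvp,
    ae_restrict_mem hO.measurableSet] with x hx hxO
  rw [(InnerProductSpace.laplacian_congr_nhds
    (hvp.eventuallyEq_of_mem (hO.mem_nhds hxO))).eq_of_nhds,
    laplacian_eq_sum_fderiv hp.contDiffAt, Finset.sum_apply]
  exact Finset.sum_congr rfl fun i _ => (hx i).symm

lemma enorm_add_sq_le (a b : ℝ) : ‖a + b‖ₑ ^ 2 ≤ 2 * (‖a‖ₑ ^ 2 + ‖b‖ₑ ^ 2) := by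
  calc ‖a + b‖ₑ ^ 2 = ENNReal.ofReal ((a + b) ^ 2) := by
        rw [← enorm_pow, Real.enorm_of_nonneg (sq_nonneg _)]
    _ ≤ ENNReal.ofReal (2 * (a ^ 2 + b ^ 2)) := ENNReal.ofReal_le_ofReal add_sq_le
    _ = 2 * (‖a‖ₑ ^ 2 + ‖b‖ₑ ^ 2) := by
        rw [ENNReal.ofReal_mul zero_le_two, ENNReal.ofReal_add (sq_nonneg a) (sq_nonneg b),
          ENNReal.ofReal_ofNat, ← enorm_pow, ← enorm_pow, Real.enorm_of_nonneg (sq_nonneg a),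
          Real.enorm_of_nonneg (sq_nonneg b)]

lemma lintegral_sum_sq_le {U : Set Plane} {v : Plane → ℝ} {g : Fin 2 → Fin 2 → Plane → ℝ}
    (hg : ∀ i j, IsWeakSecondDeriv U i j v (g i j)) :
    ∫⁻ x in U, ‖∑ i, g i i x‖ₑ ^ 2
      ≤ 2 * ∑ i : Fin 2, ∑ j ∈ Finset.Ici i, ∫⁻ x in U, ‖g i j x‖ₑ ^ 2 := by
  have h_meas : AEMeasurable (fun x => ‖g 0 0 x‖ₑ ^ 2) (volume.restrict U) :=
    (hg 0 0).2.1.aestronglyMeasurable.enorm.pow_const 2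
  calc ∫⁻ x in U, ‖∑ i, g i i x‖ₑ ^ 2
      ≤ ∫⁻ x in U, 2 * (‖g 0 0 x‖ₑ ^ 2 + ‖g 1 1 x‖ₑ ^ 2) :=
        lintegral_mono fun x => by
          rw [Fin.sum_univ_two]
          exact enorm_add_sq_le _ _
    _ = 2 * ∑ i : Fin 2, ∫⁻ x in U, ‖g i i x‖ₑ ^ 2 := by
        rw [lintegral_const_mul' _ _ ENNReal.ofNat_ne_top, lintegral_add_left' h_meas,
          Fin.sum_univ_two]
    _ ≤ _ := by
        gcongr with i
        exact Finset.single_le_sum (f := fun j => ∫⁻ x in U, ‖g i j x‖ₑ ^ 2)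
          (fun _ _ => zero_le) (Finset.mem_Ici.2 le_rfl)

lemma lintegral_laplacian_sq_le_h2Seminorm_sq {κ : Type*} {T : Finset κ} {O : κ → Set Plane}
    {U : Set Plane} {v : Plane → ℝ} (hO : ∀ k ∈ T, IsOpen (O k)) (hOU : ∀ k ∈ T, O k ⊆ U)
    (hv : ∀ k ∈ T, ∃ p, ContDiff ℝ 2 p ∧ EqOn v p (O k)) :
    ∫⁻ x in ⋃ k ∈ T, O k, ‖Laplacian.laplacian v x‖ₑ ^ 2 ≤ 2 * h2Seminorm U v ^ 2 := by
  set I := ∫⁻ x in ⋃ k ∈ T, O k, ‖Laplacian.laplacian v x‖ₑ ^ 2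
  suffices (I / 2) ^ (1 / 2 : ℝ) ≤ h2Seminorm U v by
    have h_sq : I / 2 ≤ h2Seminorm U v ^ 2 :=
      calc I / 2 = ((I / 2) ^ (1 / 2 : ℝ)) ^ 2 := by
            rw [← ENNReal.rpow_natCast, ← ENNReal.rpow_mul]
            norm_num
        _ ≤ _ := by gcongr
    rwa [ENNReal.div_le_iff two_ne_zero ENNReal.ofNat_ne_top, mul_comm] at h_sq
  refine le_iInf₂ fun g hg => ENNReal.rpow_le_rpow ?_ (by norm_num)
  rw [ENNReal.div_le_iff two_ne_zero ENNReal.ofNat_ne_top, mul_comm]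
  have h_ae : Laplacian.laplacian v =ᵐ[volume.restrict (⋃ k ∈ T, O k)] ∑ i, g i i := by
    refine (ae_restrict_biUnion_finset_iff _ _ _).2 fun k hk => ?_
    obtain ⟨p, hp, hvp⟩ := hv k hk
    exact laplacian_ae_eq_sum_of_isWeakSecondDeriv (fun i => hg i i) (hO k hk) (hOU k hk) hp hvp
  calc I = ∫⁻ x in ⋃ k ∈ T, O k, ‖∑ i, g i i x‖ₑ ^ 2 :=
        lintegral_congr_ae (h_ae.mono fun x hx => by simp only [hx, Finset.sum_apply])
    _ ≤ ∫⁻ x in U, ‖∑ i, g i i x‖ₑ ^ 2 := lintegral_mono_set (iUnion₂_subset hOU)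
    _ ≤ _ := lintegral_sum_sq_le hg

lemma ofReal_integral_sq {α : Type*} [MeasurableSpace α] {μ : Measure α} {f : α → ℝ}
    (hf : MemLp f 2 μ) : ENNReal.ofReal (∫ x, f x ^ 2 ∂μ) = ∫⁻ x, ‖f x‖ₑ ^ 2 ∂μ := by
  rw [ofReal_integral_eq_lintegral_ofReal hf.integrable_sq
    (Eventually.of_forall fun _ => sq_nonneg _)]
  refine lintegral_congr fun x => ?_
  rw [← enorm_pow, Real.enorm_of_nonneg (sq_nonneg _)]

namespace KnotSystem

variable {M : HierMesh} {r : ℕ} (K : KnotSystem M r)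

lemma edgePatch_subset_suppExt {τ : CellIdx} (hτ : τ ∈ M.cells) :
    (M.edgePatch τ : Set CellIdx) ⊆ K.suppExt τ := by
  rw [HierMesh.edgePatch, Finset.coe_insert]
  exact insert_subset (K.self_mem_suppExt hτ) (K.neighbors_subset_suppExt hτ)

lemma sum_integral_laplacian_sq_le_h2Seminorm_sq {F : Submodule ℝ (MvPolynomial (Fin 2) ℝ)}
    {τ : CellIdx} (hτ : τ ∈ M.cells) {U : Plane → ℝ} (hU : ∀ τ' ∈ M.cells, U ∈ M.polyOn F τ') :
    ENNReal.ofReal (∑ τ' ∈ M.edgePatch τ, ∫ x in M.cell τ', Laplacian.laplacian U x ^ 2)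
      ≤ 2 * h2Seminorm (K.suppExtDom τ) U ^ 2 := by
  have h_cells := fun τ' (h : τ' ∈ M.edgePatch τ) => HierMesh.edgePatch_subset_cells hτ h
  have h_disj := M.pairwiseDisjoint_cell.subset
    (Finset.coe_subset.2 (HierMesh.edgePatch_subset_cells hτ))
  calc ENNReal.ofReal (∑ τ' ∈ M.edgePatch τ, ∫ x in M.cell τ', Laplacian.laplacian U x ^ 2)
      = ∑ τ' ∈ M.edgePatch τ, ∫⁻ x in M.cell τ', ‖Laplacian.laplacian U x‖ₑ ^ 2 := by
        rw [ENNReal.ofReal_sum_of_nonneg fun τ' _ => by positivity]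
        exact Finset.sum_congr rfl fun τ' h => ofReal_integral_sq
          (HierMesh.memLp_cell_of_mem_polyOn
            (isHomogeneousLocalOp_laplacian.mem_polyOn (hU τ' (h_cells τ' h))))
    _ = ∫⁻ x in ⋃ τ' ∈ M.edgePatch τ, M.cell τ', ‖Laplacian.laplacian U x‖ₑ ^ 2 :=
        (lintegral_biUnion_finset h_disj (fun τ' _ => (M.isOpen_cell τ').measurableSet) _).symm
    _ ≤ 2 * h2Seminorm (K.suppExtDom τ) U ^ 2 :=
        lintegral_laplacian_sq_le_h2Seminorm_sq (fun τ' _ => M.isOpen_cell τ')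
          (fun τ' h => K.cell_subset_suppExtDom (K.edgePatch_subset_suppExt hτ h))
          fun τ' h => by
            obtain ⟨p, hp, hUp⟩ :=
              HierMesh.exists_contDiff_eqOn_of_mem_polyOn (hU τ' (h_cells τ' h))
            exact ⟨p, hp.of_le (by norm_cast), hUp⟩

end KnotSystem

end

lemma ofReal_abs_le_of_ofReal_sq_le {x C : ℝ} {H : ℝ≥0∞} (hC : 0 ≤ C)
    (h : ENNReal.ofReal (x ^ 2) ≤ ENNReal.ofReal C * H ^ 2) :
    ENNReal.ofReal |x| ≤ ENNReal.ofReal √C * H := by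
  rw [← ENNReal.pow_le_pow_left_iff two_ne_zero, mul_pow, ← ENNReal.ofReal_pow (abs_nonneg _),
    ← ENNReal.ofReal_pow (Real.sqrt_nonneg _), sq_abs, Real.sq_sqrt hC]
  exact h

theorem mainTheorem8_general (r : ℕ) :
    ∃ C : ℝ, 0 < C ∧
      ∀ (M : HierMesh) (K : KnotSystem M r), ∀ τ ∈ M.cells,
      ∀ f : Plane → ℝ, MemLp f 2 (volume.restrict (M.cell τ)) →
      ∀ V ∈ K.splineSpace, ∀ W ∈ K.splineSpace,
        ENNReal.ofReal |M.eta f V τ - M.eta f W τ|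
          ≤ ENNReal.ofReal C * h2Seminorm (K.suppExtDom τ) (V - W) := by
  obtain ⟨C, hC, h_eta⟩ :=
    HierMesh.exists_etaSq_zero_le (MvPolynomial.restrictDegree (Fin 2) ℝ r)
  refine ⟨√((C + 1) * 2), by positivity, fun M K τ hτ f hf V hV W hW => ?_⟩
  have h_poly : ∀ U ∈ K.splineSpace, ∀ τ' ∈ M.cells,
      U ∈ M.polyOn (MvPolynomial.restrictDegree (Fin 2) ℝ r) τ' :=
    fun U hU τ' hτ' => K.splineSpace_le_polyOn hτ' hU
  have h_diff := h_poly _ (K.splineSpace.sub_mem hV hW)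
  refine ofReal_abs_le_of_ofReal_sq_le (by positivity) ?_
  calc ENNReal.ofReal ((M.eta f V τ - M.eta f W τ) ^ 2)
      ≤ ENNReal.ofReal (M.etaSq 0 (V - W) τ) := ENNReal.ofReal_le_ofReal
        (HierMesh.sq_eta_sub_eta_le hτ hf (h_poly V hV) (h_poly W hW))
    _ ≤ ENNReal.ofReal (C * ∑ τ' ∈ M.edgePatch τ,
          ∫ x in M.cell τ', Laplacian.laplacian (V - W) x ^ 2) :=
        ENNReal.ofReal_le_ofReal (h_eta M τ hτ _ h_diff)
    _ ≤ ENNReal.ofReal C * (2 * h2Seminorm (K.suppExtDom τ) (V - W) ^ 2) := by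
        rw [ENNReal.ofReal_mul hC]
        exact mul_le_mul_right (K.sum_integral_laplacian_sq_le_h2Seminorm_sq hτ h_diff) _
    _ ≤ ENNReal.ofReal ((C + 1) * 2) * h2Seminorm (K.suppExtDom τ) (V - W) ^ 2 := by
        rw [ENNReal.ofReal_mul (by positivity), ENNReal.ofReal_ofNat, mul_assoc]
        gcongr
        exact le_add_of_nonneg_right zero_le_one

theorem mainTheorem8 (r : ℕ) (hr : 2 ≤ r) (cShape : ℝ) (hc : 0 < cShape) :
    ∃ C : ℝ, 0 < C ∧
      ∀ (M : HierMesh) (K : KnotSystem M r), K.ShapeRegular cShape →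
      ∀ f : Plane → ℝ, MemLp f 2 (volume.restrict M.dom) →
      ∀ τ ∈ M.cells, ∀ V ∈ K.splineSpace, ∀ W ∈ K.splineSpace,
        ENNReal.ofReal |M.eta f V τ - M.eta f W τ|
          ≤ ENNReal.ofReal C * h2Seminorm (K.suppExtDom τ) (V - W) := by
  obtain ⟨C, hC, h⟩ := mainTheorem8_general r
  exact ⟨C, hC, fun M K _ f hf τ hτ =>
    h M K τ hτ f (hf.mono_measure (Measure.restrict_mono (M.cell_subset_dom hτ) le_rfl))⟩
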